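/- Let $T=(V,E)$ be a finite tree with $n=|V|$ vertices (unrooted). A linear arrangement of $T$ is a bijection $\pi:V\to\{1,\dots,n\}$; it is planar if no two edges $\{s,t\},\{u,v\}\in E$ cross, i.e. satisfy $\pi(s)<\pi(u)<\pi(t)<\pi(v)$. Let $D_\pi(T)=\sum_{uv\in E}|\pi(u)-\pi(v)|$ and let $\mathbb{E}_{\mathrm{pl}}[D(T)]$ be the expected value of $D_\pi(T)$ for $\pi$ uniformly random among the planar arrangements of $T$. Write $\Gamma(v)$ for the set of neighbours of $v$, $\deg(v)=|\Gamma(v)|$, and $n_v(u)$ for the number of vertices of the subtree at $u$ when $T$ is rooted at $v$, i.e. the number of $w\in V$ such that $u$ lies on the path from $v$ to $w$. Then $$\mathbb{E}_{\mathrm{pl}}[D(T)]=\frac{(n-1)(3n^2+2n-2)}{6n}-\frac{1}{6n}\sum_{v\in V}(2\deg(v)-1)\sum_{u\in\Gamma(v)}n_v(u)^2 .$$ Moreover, $\mathbb{E}_{\mathrm{pl}}[D(T)]$ can be computed in linear time: there is a single random access machine program that, given $n$ and any list of the edges of an $n$-vertex tree $T$ on $\{0,\dots,n-1\}$, outputs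 natural numbers $a$ and $b\neq 0$ with $\mathbb{E}_{\mathrm{pl}}[D(T)]=a/b$ after $O(n)$ steps, where one step is one addition, truncated subtraction, multiplication, assignment, memory or input access, or jump, and all register contents stay bounded by a polynomial in $n$ (words of $O(\log n)$ bits). -/

import Mathlib

/-! ### Linear arrangements of a tree -/

namespace PlanarLin

/-- A linear arrangement: a bijection from the vertices to `n` consecutive positions
(numbered from `0`; only the order and the differences of the positions matter). -/
abbrev Arrangement (V : Type*) [Fintype V] := V ≃ Fin (Fintype.card V)

variable {V : Type*} [Fintype V] [DecidableEq V]

/-- The number of edge crossings of the arrangement `π`. Every crossing pair of edges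
`{s,t}`, `{u,v}` is counted once, through the unique naming of the four ends with
`π s < π u < π t < π v`. -/
def numCrossings (T : SimpleGraph V) [DecidableRel T.Adj] (π : Arrangement V) : ℕ :=
  (Finset.univ.filter fun q : (V × V) × (V × V) =>
    T.Adj q.1.1 q.1.2 ∧ T.Adj q.2.1 q.2.2 ∧
      π q.1.1 < π q.2.1 ∧ π q.2.1 < π q.1.2 ∧ π q.1.2 < π q.2.2).card

/-- The finite set of planar (crossing-free) arrangements. -/
def planarArrangements (T : SimpleGraph V) [DecidableRel T.Adj] : Finset (Arrangement V) :=
  Finset.univ.filter fun π => numCrossings T π = 0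

/-- The length `|π u - π v|` of the pair `uv` in the arrangement `π`. -/
def edgeLength (π : Arrangement V) : Sym2 V → ℚ :=
  Sym2.lift ⟨fun u v => |((π u : ℕ) : ℚ) - ((π v : ℕ) : ℚ)|, fun _ _ => abs_sub_comm _ _⟩

/-- The sum `D` of the edge lengths in the arrangement `π`. -/
def sumEdgeLengths (T : SimpleGraph V) [DecidableRel T.Adj] (π : Arrangement V) : ℚ :=
  ∑ e ∈ T.edgeFinset, edgeLength π e

/-- The expected value of `D` in a uniformly random planar arrangement. -/
def expectedPlanarD (T : SimpleGraph V) [DecidableRel T.Adj] : ℚ :=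
  Finset.expect (planarArrangements T) fun π => sumEdgeLengths T π

/-- The directional size `n_r(u)`: the number of vertices of the subtree at `u` when the tree
is rooted at `r`, that is, of the `w` such that `u` is on the path from the root `r` to `w`. -/
noncomputable def subtreeSize {V : Type*} (T : SimpleGraph V) (r u : V) : ℕ :=
  {w : V | ∃ p : T.Walk r w, p.IsPath ∧ u ∈ p.support}.ncard

/-! ### A random access machine -/

/-- Instructions of a random access machine with registers `R[0], R[1], …` that hold natural
numbers and with a read-only input array `I`. -/
inductive Instr where
  /-- `R[d] := k` -/
  | const (d k : ℕ)
  /-- `R[d] := R[a] + R[b]` -/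
  | add (d a b : ℕ)
  /-- `R[d] := R[a] - R[b]`, truncated at `0` -/
  | sub (d a b : ℕ)
  /-- `R[d] := R[a] * R[b]` -/
  | mul (d a b : ℕ)
  /-- `R[d] := R[R[a]]` -/
  | load (d a : ℕ)
  /-- `R[R[a]] := R[b]` -/
  | store (a b : ℕ)
  /-- `R[d] := I[R[a]]`, which is `0` beyond the end of the input -/
  | read (d a : ℕ)
  /-- go to instruction `l` -/
  | jump (l : ℕ)
  /-- go to instruction `l` if `R[a] = 0` -/
  | jumpZero (a l : ℕ)

/-- A configuration: the program counter and the registers. -/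
structure Config where
  pc : ℕ
  reg : ℕ → ℕ

/-- The initial configuration: first instruction, all registers zero. -/
def Config.init : Config := ⟨0, fun _ => 0⟩

/-- The effect of one instruction on input `I`. -/
def Instr.exec (I : List ℕ) (c : Config) : Instr → Config
  | .const d k => ⟨c.pc + 1, Function.update c.reg d k⟩
  | .add d a b => ⟨c.pc + 1, Function.update c.reg d (c.reg a + c.reg b)⟩
  | .sub d a b => ⟨c.pc + 1, Function.update c.reg d (c.reg a - c.reg b)⟩
  | .mul d a b => ⟨c.pc + 1, Function.update c.reg d (c.reg a * c.reg b)⟩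
  | .load d a => ⟨c.pc + 1, Function.update c.reg d (c.reg (c.reg a))⟩
  | .store a b => ⟨c.pc + 1, Function.update c.reg (c.reg a) (c.reg b)⟩
  | .read d a => ⟨c.pc + 1, Function.update c.reg d (I.getD (c.reg a) 0)⟩
  | .jump l => ⟨l, c.reg⟩
  | .jumpZero a l => ⟨if c.reg a = 0 then l else c.pc + 1, c.reg⟩

/-- One step of the program `P` on input `I`. The machine has halted, and the configuration
does not change any more, once the program counter is outside the program. -/
def step (P : List Instr) (I : List ℕ) (c : Config) : Config :=
  match P[c.pc]? with
  | some i => i.exec I c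
  | none => c

/-- The configuration after `t` steps of the program `P` on input `I`. -/
def runFor (P : List Instr) (I : List ℕ) (t : ℕ) : Config :=
  (step P I)^[t] Config.init

/-- On input `I` the program `P` halts after at most `time` steps with `a` in register `0`
and `b` in register `1`, and no register ever exceeds `bound`. -/
def ComputesWithin (P : List Instr) (I : List ℕ) (time bound a b : ℕ) : Prop :=
  P.length ≤ (runFor P I time).pc ∧
  (runFor P I time).reg 0 = a ∧ (runFor P I time).reg 1 = b ∧
  ∀ t r, (runFor P I t).reg r ≤ bound

/-- `L` lists every edge of `T` exactly once, in any order and with its ends in any order. -/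
def IsEdgeList {n : ℕ} (T : SimpleGraph (Fin n)) (L : List (Fin n × Fin n)) : Prop :=
  (L.map fun e => s(e.1, e.2)).Nodup ∧
  ∀ e : Sym2 (Fin n), e ∈ L.map (fun e => s(e.1, e.2)) ↔ e ∈ T.edgeSet

/-- The input array of the machine: the number `n` of vertices, followed by the two ends of
each edge in turn. -/
def encodeInput {n : ℕ} (L : List (Fin n × Fin n)) : List ℕ :=
  n :: L.flatMap fun e => [(e.1 : ℕ), (e.2 : ℕ)]

end PlanarLin

/-! ### Branches of a tree at a vertex -/

/-! Formula. A cyclic shift of the positions preserves planarity. Among its n shifts an edge of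
length ℓ keeps that length n-ℓ times and gets length n-ℓ the other ℓ times, so n·E[ℓ] = E[2ℓ(n-ℓ)]
(`card_mul_sum_edgeLength`). Removing the ends of an edge uv leaves branches at u and branches at v,
and planarity puts each of them entirely between u and v or entirely outside (`betweenInd_branch`).
With A vertices between and A' outside, ℓ = 1+A, n-ℓ = 1+A' and A+A' = n-2, hence ℓ(n-ℓ) = n-1+AA'.
Here 2AA' is the sum of the products of sizes over the ordered pairs of branches that uv separates,
so only the probability of separation is needed.

Separation depends on the cyclic order alone, so u may be shifted to the first position. Then the
branches at u are intervals, which may be permuted and individually reversed without creating a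
crossing (`reorder_mem`). Permutation gives probability 1/3 for two branches at the same end: the
branch of v has to be the middle one of three (`three_mul_card_separates`). Reversal of the branch
of v gives 1/2 for branches at different ends (`two_mul_card_separates`). The resulting value for
one edge (`sum_edgeLength_eq`) is then summed over ordered pairs of adjacent vertices.

Linear time. The formula needs only the degrees and the two directional sizes of each edge. Leaves
are cut off one at a time. Each vertex keeps its remaining degree, the sum of the labels of its
remaining neighbours, which for a leaf is the neighbour itself, and one plus the sizes of the
branches already cut off. A pointer scans the vertices once. After a cut the search looks at the
neighbour of the leaf, the only vertex that can have become a leaf (`PruneInv`, `prune_loop`). -/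

namespace PlanarLin

section Tree

variable {V : Type*} {T : SimpleGraph V}

open Classical in
/-- The second vertex of a path from `u` to `w`: for `w ≠ u`, the neighbour of `u` whose branch
contains `w`. -/
noncomputable def branch (T : SimpleGraph V) (u w : V) : V :=
  if h : ∃ p : T.Walk u w, p.IsPath then h.choose.snd else u

theorem branch_eq_snd (hT : T.IsTree) {u w : V} {p : T.Walk u w} (hp : p.IsPath) :
    branch T u w = p.snd := by
  have h : ∃ p : T.Walk u w, p.IsPath := ⟨p, hp⟩
  rw [branch, dif_pos h]
  congr 1
  exact (hT.existsUnique_path u w).unique h.choose_spec hp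

theorem exists_isPath (hT : T.IsTree) (u w : V) : ∃ p : T.Walk u w, p.IsPath :=
  (hT.existsUnique_path u w).exists

theorem branch_self (hT : T.IsTree) (u : V) : branch T u u = u := by
  rw [branch_eq_snd hT (p := SimpleGraph.Walk.nil) (by simp)]
  rfl

theorem adj_branch (hT : T.IsTree) {u w : V} (h : w ≠ u) : T.Adj u (branch T u w) := by
  obtain ⟨p, hp⟩ := exists_isPath hT u w
  rw [branch_eq_snd hT hp]
  exact p.adj_snd (SimpleGraph.Walk.not_nil_of_ne h.symm)

theorem branch_eq_self_iff (hT : T.IsTree) {u w : V} : branch T u w = u ↔ w = u := by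
  refine ⟨fun h => ?_, fun h => h ▸ branch_self hT _⟩
  by_contra hne
  exact (adj_branch hT hne).ne h.symm

/-- Links `branch` to the definition of `subtreeSize`: in a tree, a neighbour of `u` on a path that
starts at `u` can only be its second vertex. -/
theorem branch_eq_iff (hT : T.IsTree) {u c w : V} (hc : T.Adj u c) :
    branch T u w = c ↔ ∃ p : T.Walk u w, p.IsPath ∧ c ∈ p.support := by
  constructor
  · intro h
    obtain ⟨p, hp⟩ := exists_isPath hT u w
    refine ⟨p, hp, ?_⟩
    rw [← h, branch_eq_snd hT hp]
    exact p.getVert_mem_support 1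
  · rintro ⟨p, hp, hm⟩
    rw [branch_eq_snd hT hp]
    exact (hT.2.eq_snd_of_adj_start hp hc hm).symm

theorem branch_of_adj (hT : T.IsTree) {u c : V} (hc : T.Adj u c) : branch T u c = c := by
  obtain ⟨p, hp⟩ := exists_isPath hT u c
  exact (branch_eq_iff hT hc).2 ⟨p, hp, p.end_mem_support⟩

/-- The path from `u` to `x` either passes through `y`, and is truncated there, or extends by the
edge to `y`; the second vertex is the same in both cases. -/
theorem branch_eq_of_adj (hT : T.IsTree) {u x y : V} (hx : x ≠ u) (hy : y ≠ u)
    (hxy : T.Adj x y) : branch T u x = branch T u y := by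
  classical
  obtain ⟨p, hp⟩ := exists_isPath hT u x
  by_cases hm : y ∈ p.support
  · rw [branch_eq_snd hT hp, branch_eq_snd hT (hp.takeUntil hm), p.snd_takeUntil hy hm]
  · have hq : (p.concat hxy).IsPath := hp.concat hm hxy
    symm
    rw [branch_eq_iff hT (adj_branch hT hx)]
    refine ⟨_, hq, ?_⟩
    rw [SimpleGraph.Walk.support_concat, branch_eq_snd hT hp]
    exact List.mem_append_left _ (p.getVert_mem_support 1)

/-- Deleting an edge leaves two sides: `w` is on the side of `v` or on the side of `u`. -/
theorem branch_eq_iff_branch_ne (hT : T.IsTree) {u v : V} (h : T.Adj u v) (w : V) :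
    branch T u w = v ↔ branch T v w ≠ u := by
  constructor
  · intro hb hu
    obtain ⟨p, hp⟩ := exists_isPath hT u w
    rw [branch_eq_snd hT hp] at hb
    cases p with
    | nil => exact h.ne hb
    | cons h' q =>
      rw [SimpleGraph.Walk.snd_cons] at hb
      subst hb
      rw [SimpleGraph.Walk.cons_isPath_iff] at hp
      apply hp.2
      rw [← hu, branch_eq_snd hT hp.1]
      exact q.getVert_mem_support 1
  · intro hne
    obtain ⟨q, hq⟩ := exists_isPath hT v w
    have hu : u ∉ q.support := fun hm => hne ((branch_eq_iff hT h.symm).2 ⟨q, hq, hm⟩)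
    rw [branch_eq_snd hT (p := .cons h q) (by simp [hq, hu]), SimpleGraph.Walk.snd_cons]

/-- Reachability inside the set `S`. -/
def ConnIn (T : SimpleGraph V) (S : Set V) : V → V → Prop :=
  Relation.ReflTransGen fun a b => T.Adj a b ∧ a ∈ S ∧ b ∈ S

theorem ConnIn.symm {S : Set V} {a b : V} (h : ConnIn T S a b) : ConnIn T S b a := by
  unfold ConnIn at *
  induction h with
  | refl => exact .refl
  | tail _ h ih => exact .head ⟨h.1.symm, h.2.2, h.2.1⟩ ih

theorem connIn_of_walk {S : Set V} {a b : V} (p : T.Walk a b) (h : ∀ x ∈ p.support, x ∈ S) :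
    ConnIn T S a b := by
  induction p with
  | nil => exact .refl
  | cons hadj q ih =>
    refine .head ⟨hadj, h _ (by simp), h _ (by simp)⟩ (ih fun x hx => h x (by simp [hx]))

/-- Without its first vertex, the path from `u` to `w` is a walk that avoids `u`, and such a walk
never changes branch. -/
theorem connIn_branch (hT : T.IsTree) {u w : V} (hw : w ≠ u) :
    ConnIn T {x | branch T u x = branch T u w} (branch T u w) w := by
  obtain ⟨p, hp⟩ := exists_isPath hT u w
  cases p with
  | nil => exact absurd rfl hw
  | @cons _ c _ h q =>
    have hb : branch T u w = c := (branch_eq_snd hT hp).trans (q.snd_cons h)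
    rw [hb]
    rw [SimpleGraph.Walk.cons_isPath_iff] at hp
    have key : ∀ {a b : V} (q : T.Walk a b), u ∉ q.support →
        ∀ x ∈ q.support, branch T u x = branch T u a := by
      intro a b q
      induction q with
      | nil => simp
      | @cons a a' b hadj q ih =>
        intro hu x hx
        simp only [SimpleGraph.Walk.support_cons, List.mem_cons, not_or] at hu hx
        rcases hx with rfl | hx
        · rfl
        · rw [ih hu.2 x hx]
          refine branch_eq_of_adj hT ?_ (Ne.symm hu.1) hadj.symm
          rintro rfl
          exact hu.2 q.start_mem_support
    refine connIn_of_walk q fun x hx => ?_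
    rw [Set.mem_ofPred_eq, key q hp.2 x hx, branch_of_adj hT h]

end Tree

/-! ### Sizes of branches. -/

section Sizes

variable {V : Type*} [Fintype V] [DecidableEq V] {T : SimpleGraph V}

theorem subtreeSize_eq_card (hT : T.IsTree) {u c : V} (hc : T.Adj u c) :
    subtreeSize T u c = (Finset.univ.filter fun w => branch T u w = c).card := by
  rw [subtreeSize, ← Set.ncard_coe_finset]
  congr 1
  ext w
  simp [branch_eq_iff hT hc]

theorem subtreeSize_add (hT : T.IsTree) {u v : V} (h : T.Adj u v) :
    subtreeSize T u v + subtreeSize T v u = Fintype.card V := by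
  rw [subtreeSize_eq_card hT h, subtreeSize_eq_card hT h.symm, ← Finset.card_univ,
    ← Finset.card_filter_add_card_filter_not (s := Finset.univ) (fun w => branch T u w = v)]
  congr 2
  ext w
  simp [branch_eq_iff_branch_ne hT h w]

theorem sum_branches (hT : T.IsTree) [DecidableRel T.Adj] {M : Type*} [AddCommMonoid M] (u : V)
    (f : V → M) :
    ∑ w, f w = f u + ∑ c ∈ T.neighborFinset u, ∑ w with branch T u w = c, f w := by
  rw [← Finset.add_sum_erase _ _ (Finset.mem_univ u)]
  congr 1
  rw [← Finset.sum_fiberwise_of_maps_to (t := T.neighborFinset u) (g := branch T u)]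
  · refine Finset.sum_congr rfl fun c hc => Finset.sum_congr ?_ fun _ _ => rfl
    ext w
    simp only [Finset.mem_filter, Finset.mem_erase, Finset.mem_univ, and_true, true_and]
    refine and_iff_right_of_imp ?_
    rintro h rfl
    rw [branch_self hT] at h
    subst h
    simp at hc
  · intro w hw
    simpa using adj_branch hT (Finset.ne_of_mem_erase hw)

theorem sum_subtreeSize (hT : T.IsTree) [DecidableRel T.Adj] (u : V) :
    1 + ∑ c ∈ T.neighborFinset u, subtreeSize T u c = Fintype.card V := by
  have h := sum_branches hT u (fun _ => 1)
  simp only [Finset.sum_const, smul_eq_mul, mul_one, Finset.card_univ] at h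
  rw [h]
  congr 1
  refine Finset.sum_congr rfl fun c hc => ?_
  rw [subtreeSize_eq_card hT (by simpa using hc)]

/-- A subforest, given by its neighbourhoods, that has no leaf has no edge. -/
theorem eq_empty_of_card_ne_one (hT : T.IsTree) {N : V → Finset V}
    (hsymm : ∀ x y, y ∈ N x → x ∈ N y) (hN : ∀ x y, y ∈ N x → T.Adj x y)
    (hleaf : ∀ x, (N x).card ≠ 1) (x : V) : N x = ∅ := by
  classical
  -- Infinite descent along directed edges: `y` is not a leaf, so the walk continues to some `z ≠
  -- x`, and the subtree ahead becomes strictly smaller.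
  have key : ∀ m : ℕ, ∀ x y, y ∈ N x → subtreeSize T x y = m → False := by
    intro m
    induction m using Nat.strong_induction_on with
    | _ m ih =>
      intro x y hxy hm
      have hyx := hsymm x y hxy
      have hadj := hN x y hxy
      obtain ⟨z, hz, hzx⟩ : ∃ z ∈ N y, z ≠ x := by
        by_contra! hall
        apply hleaf y
        rw [Finset.card_eq_one]
        exact ⟨x, Finset.eq_singleton_iff_unique_mem.2 ⟨hyx, hall⟩⟩
      refine ih (subtreeSize T y z) ?_ y z hz rfl
      have h1 := subtreeSize_add hT hadj
      have h2 := sum_subtreeSize hT y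
      have h3 : ∑ c ∈ ({x, z} : Finset V), subtreeSize T y c ≤
          ∑ c ∈ T.neighborFinset y, subtreeSize T y c := by
        refine Finset.sum_le_sum_of_subset ?_
        intro c hc
        simp only [Finset.mem_insert, Finset.mem_singleton] at hc
        rcases hc with rfl | rfl <;> simpa using hN _ _ ‹_›
      rw [Finset.sum_pair hzx.symm] at h3
      omega
  rw [Finset.eq_empty_iff_forall_notMem]
  exact fun y hy => key _ x y hy rfl

end Sizes

end PlanarLin

/-! ### Noncrossing arrangements -/

namespace PlanarLin

section Noncrossing

variable {V : Type*}

/-- No two pairs that are related by `A` cross in the order given by `f`. -/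
def Noncrossing (A : V → V → Prop) (f : V → ℕ) : Prop :=
  ∀ s t p q, A s t → A p q → ¬ (f s < f p ∧ f p < f t ∧ f t < f q)

/-- `x` is strictly between `p` and `q` in the order given by `f`. -/
def Between (f : V → ℕ) (p q x : V) : Prop :=
  (f p < f x ∧ f x < f q) ∨ (f q < f x ∧ f x < f p)

variable {T : SimpleGraph V} {f : V → ℕ}

/-- An edge with one end between `p` and `q` and the other outside would cross `pq`; the eight
instances cover all orientations of the two edges and both their roles. -/
theorem Noncrossing.between_iff_of_adj (hf : Noncrossing T.Adj f) (hinj : Function.Injective f)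
    {p q x y : V} (hpq : T.Adj p q) (hxy : T.Adj x y) (hxp : x ≠ p) (hxq : x ≠ q) (hyp : y ≠ p)
    (hyq : y ≠ q) : Between f p q x ↔ Between f p q y := by
  have h1 := hf p q x y hpq hxy
  have h2 := hf q p x y hpq.symm hxy
  have h3 := hf p q y x hpq hxy.symm
  have h4 := hf q p y x hpq.symm hxy.symm
  have h5 := hf x y p q hxy hpq
  have h6 := hf x y q p hxy hpq.symm
  have h7 := hf y x p q hxy.symm hpq
  have h8 := hf y x q p hxy.symm hpq.symm
  have := hinj.ne hxp
  have := hinj.ne hxq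
  have := hinj.ne hyp
  have := hinj.ne hyq
  unfold Between
  omega

/-- A connected set that avoids the ends of an edge lies on one side of it. -/
theorem Noncrossing.between_iff_of_connIn (hf : Noncrossing T.Adj f)
    (hinj : Function.Injective f) {p q : V} (hpq : T.Adj p q) {S : Set V} (hp : p ∉ S)
    (hq : q ∉ S) {a b : V} (hab : ConnIn T S a b) : Between f p q a ↔ Between f p q b := by
  unfold ConnIn at hab
  induction hab with
  | refl => rfl
  | tail _ h ih =>
    rw [ih]
    obtain ⟨hadj, hx, hy⟩ := h
    exact hf.between_iff_of_adj hinj hpq hadj (ne_of_mem_of_not_mem hx hp)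
      (ne_of_mem_of_not_mem hx hq) (ne_of_mem_of_not_mem hy hp) (ne_of_mem_of_not_mem hy hq)

/-- Disjoint connected sets do not cross. -/
theorem Noncrossing.between_iff_of_disjoint (hf : Noncrossing T.Adj f)
    (hinj : Function.Injective f) {S R : Set V} (hSR : Disjoint S R) {s t a b : V} (hs : s ∈ S)
    (ht : t ∈ S) (hst : ConnIn T S s t) (hab : ConnIn T R a b) :
    Between f s t a ↔ Between f s t b := by
  unfold ConnIn at hab
  induction hab with
  | refl => rfl
  | @tail x y _ h ih =>
    rw [ih]
    obtain ⟨hadj, hx, hy⟩ := h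
    -- Alternation is symmetric: `s`, `t` separate `x` from `y` exactly if `x`, `y` separate `s`
    -- from `t`. So the result for one edge applies to `xy` and the connected set `S`.
    have key := hf.between_iff_of_connIn hinj hadj (Set.disjoint_right.1 hSR hx)
      (Set.disjoint_right.1 hSR hy) hst
    have := hinj.ne (hSR.ne_of_mem hs hx)
    have := hinj.ne (hSR.ne_of_mem hs hy)
    have := hinj.ne (hSR.ne_of_mem ht hx)
    have := hinj.ne (hSR.ne_of_mem ht hy)
    have := hinj.ne hadj.ne
    unfold Between at *
    omega

/-- If `u` comes first, then every branch at `u` is an interval. -/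
theorem Noncrossing.branch_eq_of_lt_of_lt (hT : T.IsTree) (hf : Noncrossing T.Adj f)
    (hinj : Function.Injective f) {u : V} (hu : f u = 0) {x y z : V} (hx : x ≠ u)
    (hxz : branch T u x = branch T u z) (hxy : f x < f y) (hyz : f y < f z) :
    branch T u y = branch T u x := by
  by_contra hne
  have hux : 0 < f x := by
    have := hinj.ne hx
    omega
  have hyu : y ≠ u := by
    rintro rfl
    omega
  have hzu : z ≠ u := by
    rintro rfl
    omega
  -- Together with `u`, the branch of `y` is a connected set that is disjoint from the branch of
  -- `x`. In the order `u`, `x`, `y`, `z` the two sets would cross.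
  have hS : ConnIn T (insert u {w | branch T u w = branch T u y}) u y := by
    refine .head ⟨adj_branch hT hyu, Set.mem_insert _ _, Set.mem_insert_of_mem _ ?_⟩
      (Relation.ReflTransGen.mono ?_ _ _ (connIn_branch hT hyu))
    · exact branch_of_adj hT (adj_branch hT hyu)
    · rintro a b ⟨h, ha, hb⟩
      exact ⟨h, Set.mem_insert_of_mem _ ha, Set.mem_insert_of_mem _ hb⟩
  have hR : ConnIn T {w | branch T u w = branch T u x} x z := by
    have h1 := (connIn_branch hT hx).symm
    have h2 := connIn_branch hT hzu
    rw [← hxz] at h2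
    exact h1.trans h2
  have hdis : Disjoint (insert u {w | branch T u w = branch T u y})
      {w | branch T u w = branch T u x} := by
    rw [Set.disjoint_left]
    rintro w (rfl | hw) hw'
    · have hw'' : branch T w w = branch T w x := hw'
      rw [branch_self hT] at hw''
      exact hx ((branch_eq_self_iff hT).1 hw''.symm)
    · exact hne (Eq.trans (Eq.symm hw) hw')
  have key := hf.between_iff_of_disjoint hinj hdis (Set.mem_insert _ _)
    (Set.mem_insert_of_mem _ rfl) hS hR
  unfold Between at key
  omega

/-- A cyclic shift of the positions creates no crossing. -/
theorem Noncrossing.rotate {A : V → V → Prop} (hA : ∀ x y, A x y → A y x)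
    (hf : Noncrossing A f) {n : ℕ} (hn : ∀ v, f v < n) (r : ℕ) :
    Noncrossing A fun v => if f v + r < n then f v + r else f v + r - n := by
  intro s t p q hst hpq
  -- Undoing the shift turns a crossing into one whose four ends are read from another starting
  -- point of the same cyclic order; there are four starting points.
  have h1 := hf s t p q hst hpq
  have h2 := hf p q t s hpq (hA _ _ hst)
  have h3 := hf t s q p (hA _ _ hst) (hA _ _ hpq)
  have h4 := hf q p s t (hA _ _ hpq) hst
  have := hn s
  have := hn t
  have := hn p
  have := hn q
  dsimp only
  split_ifs <;> omega

/-- The neighbourhoods of a forest after the leaf `v` has been cut off. -/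
def prune [DecidableEq V] (N : V → Finset V) (v x : V) : Finset V :=
  if x = v then ∅ else (N x).erase v

theorem mem_prune [DecidableEq V] {N : V → Finset V} {v x y : V} :
    y ∈ prune N v x ↔ x ≠ v ∧ y ≠ v ∧ y ∈ N x := by
  unfold prune
  split_ifs with h <;> simp [h]

theorem card_prune_le [DecidableEq V] (N : V → Finset V) (v x : V) :
    (prune N v x).card ≤ (N x).card :=
  Finset.card_le_card fun _ hy => (mem_prune.1 hy).2.2

/-- Induction over subforests: cut off a leaf, arrange the rest, and reinsert the leaf immediately
after its neighbour, where its edge spans no other vertex. -/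
theorem exists_noncrossing [Fintype V] [DecidableEq V] (hT : T.IsTree) (m : ℕ) :
    ∀ N : V → Finset V, (∀ x y, y ∈ N x → x ∈ N y) → (∀ x y, y ∈ N x → T.Adj x y) →
      ∑ x, (N x).card = m →
      ∃ f : V → ℕ, Function.Injective f ∧ Noncrossing (fun x y => y ∈ N x) f := by
  induction m using Nat.strong_induction_on with
  | _ m ih =>
    intro N hsymm hN hm
    by_cases hleaf : ∀ x, (N x).card ≠ 1
    · refine ⟨fun v => (Fintype.equivFin V v : ℕ), fun a b h => ?_, fun s t p q hst => ?_⟩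
      · exact (Fintype.equivFin V).injective (Fin.ext h)
      · dsimp only at hst
        rw [eq_empty_of_card_ne_one hT hsymm hN hleaf s] at hst
        exact absurd hst (Finset.notMem_empty _)
    push Not at hleaf
    obtain ⟨v, hv⟩ := hleaf
    obtain ⟨p, hp⟩ := Finset.card_eq_one.1 hv
    have hpv : p ∈ N v := by simp [hp]
    have hvp : p ≠ v := (hN _ _ hpv).ne'
    obtain ⟨f, hinj, hf⟩ := ih (∑ x, (prune N v x).card) (by
        rw [← hm]
        refine Finset.sum_lt_sum (fun x _ => card_prune_le N v x) ⟨v, Finset.mem_univ _, ?_⟩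
        rw [hv]
        simp [prune]) (prune N v)
      (fun x y h => by
        rw [mem_prune] at *
        exact ⟨h.2.1, h.1, hsymm _ _ h.2.2⟩)
      (fun x y h => hN x y (mem_prune.1 h).2.2) rfl
    -- Doubling all positions frees the odd slot directly behind `p`.
    refine ⟨fun w => if w = v then 2 * f p + 1 else 2 * f w, fun a b hab => ?_, ?_⟩
    · dsimp only at hab
      split_ifs at hab with h1 h2 h2
      · rw [h1, h2]
      · omega
      · omega
      · exact hinj (by omega)
    · intro s t a b hst hab hlt
      have hother : ∀ x y, y ∈ N x → x = v → y = p := by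
        rintro x y h rfl
        simpa [hp] using h
      have key := hf s t a b
      simp only [mem_prune] at key
      have e1 := hother s t hst
      have e2 := hother t s (hsymm _ _ hst)
      have e3 := hother a b hab
      have e4 := hother b a (hsymm _ _ hab)
      dsimp only at hlt
      by_cases hs : s = v
      · rw [e1 hs, if_pos hs, if_neg hvp] at hlt
        omega
      by_cases ht : t = v
      · rw [e2 ht, if_pos ht, if_neg hvp] at hlt
        split_ifs at hlt <;> omega
      by_cases ha : a = v
      · rw [e3 ha, if_pos ha, if_neg hvp, if_neg hs, if_neg ht] at hlt
        omega
      by_cases hb : b = v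
      · rw [e4 hb, if_pos hb, if_neg hvp, if_neg hs, if_neg ht] at hlt
        omega
      rw [if_neg hs, if_neg ht, if_neg ha, if_neg hb] at hlt
      exact key ⟨hs, ht, hst⟩ ⟨ha, hb, hab⟩ (by omega)

end Noncrossing

/-! ### Arrangements as linear orders, and their cyclic shifts. -/

section Arrangements

variable {V : Type*} [Fintype V]

/-- The position of a vertex, as a natural number. -/
def pos (π : Arrangement V) (v : V) : ℕ := π v

theorem pos_injective (π : Arrangement V) : Function.Injective (pos π) :=
  fun _ _ h => π.injective (Fin.ext h)

theorem pos_lt (π : Arrangement V) (v : V) : pos π v < Fintype.card V := (π v).2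

theorem mem_planarArrangements [DecidableEq V] {T : SimpleGraph V} [DecidableRel T.Adj]
    {π : Arrangement V} :
    π ∈ planarArrangements T ↔ Noncrossing T.Adj (pos π) := by
  simp only [planarArrangements, numCrossings, Finset.mem_filter, Finset.mem_univ, true_and,
    Finset.card_eq_zero, Finset.filter_eq_empty_iff, Prod.forall, Noncrossing, pos,
    Fin.lt_def, not_and, forall_const]

/-- Sorting by `key`: the position of a vertex is the number of vertices with a smaller key. -/
theorem exists_arrangement {K : Type*} [LinearOrder K] {key : V → K}
    (hkey : Function.Injective key) :
    ∃ π : Arrangement V, ∀ x y, pos π x < pos π y ↔ key x < key y := by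
  let r : V → Fin (Fintype.card V) := fun x =>
    ⟨(Finset.univ.filter fun y => key y < key x).card, by
      refine Finset.card_lt_univ_of_notMem (x := x) ?_
      simp⟩
  have hmono : ∀ x y, key x < key y → r x < r y := by
    intro x y h
    rw [Fin.lt_def]
    refine Finset.card_lt_card (Finset.ssubset_iff_of_subset ?_ |>.2 ⟨x, by simp [h], by simp⟩)
    intro z hz
    simp only [Finset.mem_filter, Finset.mem_univ, true_and] at hz ⊢
    exact hz.trans h
  have hinj : Function.Injective r := by
    intro x y h
    by_contra hne
    rcases lt_or_gt_of_ne (hkey.ne hne) with h' | h'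
    · exact (hmono _ _ h').ne h
    · exact (hmono _ _ h').ne h.symm
  refine ⟨Equiv.ofBijective r ((Fintype.bijective_iff_injective_and_card r).2
    ⟨hinj, by simp⟩), fun x y => ⟨fun h => ?_, fun h => hmono x y h⟩⟩
  by_contra hle
  rcases (not_lt.1 hle).eq_or_lt with h' | h'
  · rw [hkey h'] at h
    exact lt_irrefl _ h
  · exact lt_asymm h (hmono y x h')

theorem card_lt_pos (π : Arrangement V) (x : V) :
    (Finset.univ.filter fun y => pos π y < pos π x).card = pos π x := by
  have : (Finset.univ.filter fun y => pos π y < pos π x).map π.toEmbedding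
      = Finset.Iio (π x) := by
    ext i
    simp only [Finset.mem_map, Finset.mem_filter, Finset.mem_univ, true_and, Finset.mem_Iio,
      Equiv.coe_toEmbedding, pos, ← Fin.lt_def]
    exact ⟨fun ⟨y, hy, h⟩ => h ▸ hy, fun h => ⟨π.symm i, by simpa using h, by simp⟩⟩
  rw [← Finset.card_map, this, Fin.card_Iio]
  rfl

theorem arrangement_ext {π ρ : Arrangement V}
    (h : ∀ x y, pos π x < pos π y ↔ pos ρ x < pos ρ y) : π = ρ := by
  ext x
  change pos π x = pos ρ x
  rw [← card_lt_pos π, ← card_lt_pos ρ]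
  simp only [h]

/-- Needed for the expectation, which divides by the number of planar arrangements. -/
theorem planarArrangements_nonempty [DecidableEq V] {T : SimpleGraph V} [DecidableRel T.Adj]
    (hT : T.IsTree) :
    (planarArrangements T).Nonempty := by
  obtain ⟨f, hinj, hf⟩ := exists_noncrossing hT _ (fun v => T.neighborFinset v)
    (fun x y h => by simpa using (show T.Adj x y by simpa using h).symm)
    (fun x y h => by simpa using h) rfl
  obtain ⟨π, hπ⟩ := exists_arrangement hinj
  refine ⟨π, mem_planarArrangements.2 fun s t p q hst hpq => ?_⟩
  rw [hπ, hπ, hπ]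
  exact hf s t p q (by simpa using hst) (by simpa using hpq)

/-- The arrangement after a cyclic shift of the positions. -/
def rotate [Nonempty V] (r : Fin (Fintype.card V)) (π : Arrangement V) : Arrangement V :=
  π.trans (Equiv.addRight r)

theorem pos_rotate [Nonempty V] (r : Fin (Fintype.card V)) (π : Arrangement V) (v : V) :
    pos (rotate r π) v = if pos π v + r < Fintype.card V then pos π v + r
      else pos π v + r - Fintype.card V := by
  have h : pos (rotate r π) v = (pos π v + r) % Fintype.card V := by
    simp [pos, rotate, Fin.val_add]
  have h1 := pos_lt π v
  have h2 := r.2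
  rw [h]
  split_ifs with hlt
  · exact Nat.mod_eq_of_lt hlt
  · rw [Nat.mod_eq_sub_mod (by omega), Nat.mod_eq_of_lt (by omega)]

theorem rotate_injective [Nonempty V] (r : Fin (Fintype.card V)) :
    Function.Injective (rotate (V := V) r) := by
  intro π ρ h
  ext v
  have := congrArg (fun σ : Arrangement V => σ v) h
  simp only [rotate, Equiv.trans_apply, Equiv.coe_addRight, add_left_inj] at this
  rw [this]

theorem rotate_mem [Nonempty V] [DecidableEq V] {T : SimpleGraph V} [DecidableRel T.Adj]
    (r : Fin (Fintype.card V)) {π : Arrangement V} (h : π ∈ planarArrangements T) :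
    rotate r π ∈ planarArrangements T := by
  rw [mem_planarArrangements] at *
  have := h.rotate (fun _ _ h => h.symm) (pos_lt π) r
  rwa [← show pos (rotate r π) = _ from funext (pos_rotate r π)] at this

end Arrangements

end PlanarLin

/-! ### Reordering and reversing the branches at a vertex -/

namespace PlanarLin

/-- The pair `u`, `v` separates `a` from `b` in the order given by `f`. -/
def Separates {V : Type*} (f : V → ℕ) (u v a b : V) : Prop := ¬ (Between f u v a ↔ Between f u v b)

/-- Betweenness is not invariant under shifts, but a shift that exchanges inside and outside does so
for `a` and `b` alike. -/
theorem separates_rotate {V : Type*} [Fintype V] [Nonempty V] (r : Fin (Fintype.card V))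
    (π : Arrangement V) {u v a b : V} (hua : u ≠ a) (hub : u ≠ b) (hva : v ≠ a) (hvb : v ≠ b) :
    Separates (pos (rotate r π)) u v a b ↔ Separates (pos π) u v a b := by
  have h1 := (pos_injective π).ne hua
  have h2 := (pos_injective π).ne hub
  have h3 := (pos_injective π).ne hva
  have h4 := (pos_injective π).ne hvb
  have := pos_lt π u
  have := pos_lt π v
  have := pos_lt π a
  have := pos_lt π b
  have := r.2
  unfold Separates Between
  simp only [pos_rotate]
  split_ifs <;> omega

section ReorderKey

variable {V : Type*} [Fintype V] [DecidableEq V] {T : SimpleGraph V}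

/-- The sort key for permuting the branches at `u` by `σ` and reversing those in `e`. -/
noncomputable def reorderKey (T : SimpleGraph V) (u : V) (σ : Equiv.Perm V) (e : Finset V)
    (π : Arrangement V) (w : V) : ℕ ×ₗ ℕ :=
  toLex (pos π (σ (branch T u w)),
    if branch T u w ∈ e then Fintype.card V - pos π w else pos π w)

theorem reorderKey_lt (u : V) (σ : Equiv.Perm V) (e : Finset V) (π : Arrangement V) (x y : V) :
    reorderKey T u σ e π x < reorderKey T u σ e π y ↔
      if branch T u x = branch T u y then
        if branch T u x ∈ e then pos π y < pos π x else pos π x < pos π y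
      else pos π (σ (branch T u x)) < pos π (σ (branch T u y)) := by
  rw [reorderKey, reorderKey, Prod.Lex.toLex_lt_toLex]
  have h1 := pos_lt π x
  have h2 := pos_lt π y
  by_cases h : branch T u x = branch T u y
  · rw [if_pos h, h]
    by_cases h' : branch T u y ∈ e
    · simp only [h', if_true, lt_irrefl, true_and, false_or]
      omega
    · simp [h']
  · rw [if_neg h]
    have : pos π (σ (branch T u x)) ≠ pos π (σ (branch T u y)) :=
      (pos_injective π).ne (σ.injective.ne h)
    simp [this]

theorem reorderKey_injective (u : V) (σ : Equiv.Perm V) (e : Finset V) (π : Arrangement V) :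
    Function.Injective (reorderKey T u σ e π) := by
  intro x y h
  have h1 : ¬ reorderKey T u σ e π x < reorderKey T u σ e π y := h ▸ lt_irrefl _
  have h2 : ¬ reorderKey T u σ e π y < reorderKey T u σ e π x := h ▸ lt_irrefl _
  rw [reorderKey_lt] at h1 h2
  by_cases hb : branch T u x = branch T u y
  · rw [if_pos hb] at h1
    rw [if_pos hb.symm, ← hb] at h2
    apply pos_injective π
    split_ifs at h1 h2 <;> omega
  · rw [if_neg hb] at h1
    rw [if_neg (Ne.symm hb)] at h2
    exact absurd (σ.injective (pos_injective π (by omega))) hb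

/-- The arrangement in which the branches at `u` are permuted by `σ` and those in `e` are
reversed. -/
noncomputable def reorder (T : SimpleGraph V) (u : V) (σ : Equiv.Perm V) (e : Finset V)
    (π : Arrangement V) : Arrangement V :=
  (exists_arrangement (reorderKey_injective (T := T) u σ e π)).choose

theorem pos_reorder_lt (u : V) (σ : Equiv.Perm V) (e : Finset V) (π : Arrangement V) (x y : V) :
    pos (reorder T u σ e π) x < pos (reorder T u σ e π) y ↔
      if branch T u x = branch T u y then
        if branch T u x ∈ e then pos π y < pos π x else pos π x < pos π y
      else pos π (σ (branch T u x)) < pos π (σ (branch T u y)) :=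
  ((exists_arrangement (reorderKey_injective (T := T) u σ e π)).choose_spec x y).trans
    (reorderKey_lt u σ e π x y)

end ReorderKey

variable {V : Type*} [Fintype V] [DecidableEq V] {T : SimpleGraph V} [DecidableRel T.Adj]

/-- The planar arrangements with `u` in the first position. -/
def planarAt (T : SimpleGraph V) [DecidableRel T.Adj] (u : V) : Finset (Arrangement V) :=
  (planarArrangements T).filter fun π => pos π u = 0

theorem mem_planarAt {u : V} {π : Arrangement V} :
    π ∈ planarAt T u ↔ Noncrossing T.Adj (pos π) ∧ pos π u = 0 := by
  rw [planarAt, Finset.mem_filter, mem_planarArrangements]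

/-- Distinct branches at the first vertex are disjoint intervals, so any representatives may be used
to compare them. -/
theorem pos_lt_iff_of_branch (hT : T.IsTree) {u : V} {π : Arrangement V} (hπ : π ∈ planarAt T u)
    {x x' y y' : V} (hx : x ≠ u) (hx' : x' ≠ u) (hy : y ≠ u) (hy' : y' ≠ u)
    (hxx : branch T u x = branch T u x') (hyy : branch T u y = branch T u y')
    (hne : branch T u x ≠ branch T u y) : pos π x < pos π y ↔ pos π x' < pos π y' := by
  rw [mem_planarAt] at hπ
  have key : ∀ {x x' y y' : V}, x ≠ u → y' ≠ u → branch T u x = branch T u x' →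
      branch T u y = branch T u y' → branch T u x ≠ branch T u y → pos π x < pos π y →
      pos π x' < pos π y' := by
    intro x x' y y' hx hy' hxx hyy hne h
    by_contra hle
    have h1 : pos π x' ≠ pos π y' := (pos_injective π).ne
      (by rintro rfl; exact hne (hxx.trans hyy.symm))
    have h2 : pos π x ≠ pos π y' := (pos_injective π).ne (by rintro rfl; exact hne hyy.symm)
    rcases lt_or_gt_of_ne h2 with h3 | h3
    · exact hne ((hπ.1.branch_eq_of_lt_of_lt hT (pos_injective π) hπ.2 hx hxx h3
        (by omega)).symm.trans hyy.symm)
    · exact hne ((hπ.1.branch_eq_of_lt_of_lt hT (pos_injective π) hπ.2 hy' hyy.symm h3 h).trans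
        hyy.symm)
  exact ⟨key hx hy' hxx hyy hne, key hx' hy hxx.symm hyy.symm (by rwa [← hxx, ← hyy])⟩

/-- If the branches at the first vertex remain intervals and the order inside each of them is
kept or reversed, then the arrangement remains planar. -/
theorem mem_planarAt_of_reorder (hT : T.IsTree) {u : V} {π ρ : Arrangement V}
    (hπ : π ∈ planarAt T u) (hu : pos ρ u = 0)
    (hconv : ∀ x y z, x ≠ u → branch T u x = branch T u z → pos ρ x < pos ρ y →
      pos ρ y < pos ρ z → branch T u y = branch T u x)
    (hord : ∀ c, (∀ x y, branch T u x = c → branch T u y = c →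
        (pos ρ x < pos ρ y ↔ pos π x < pos π y)) ∨
      (∀ x y, branch T u x = c → branch T u y = c →
        (pos ρ x < pos ρ y ↔ pos π y < pos π x))) :
    ρ ∈ planarAt T u := by
  rw [mem_planarAt] at *
  refine ⟨fun s t p q hst hpq ⟨h1, h2, h3⟩ => ?_, hu⟩
  have hp : p ≠ u := by rintro rfl; omega
  have ht : t ≠ u := by rintro rfl; omega
  have hq : q ≠ u := by rintro rfl; omega
  -- A crossing lives in a single branch, with `u` possibly as its first end: `p` and `q` are
  -- adjacent, `t` lies between them, and `s` is adjacent to `t`. There the order is kept or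
  -- reversed, so the crossing was already present in `π`.
  have hpq' : branch T u p = branch T u q := branch_eq_of_adj hT hp hq hpq
  have htp : branch T u t = branch T u p := hconv p t q hp hpq' h2 h3
  have hpu : 0 < pos π p := Nat.pos_of_ne_zero fun h =>
    hp (pos_injective π (h.trans hπ.2.symm))
  have hqu : 0 < pos π q := Nat.pos_of_ne_zero fun h =>
    hq (pos_injective π (h.trans hπ.2.symm))
  by_cases hs : s = u
  · subst hs
    rcases hord (branch T s p) with h | h
    · rw [h p t rfl htp] at h2
      rw [h t q htp hpq'.symm] at h3
      exact hπ.1 s t p q hst hpq ⟨by omega, h2, h3⟩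
    · rw [h p t rfl htp] at h2
      rw [h t q htp hpq'.symm] at h3
      exact hπ.1 s t q p hst hpq.symm ⟨by omega, h3, h2⟩
  · have hst' : branch T u s = branch T u t := branch_eq_of_adj hT hs ht hst
    rcases hord (branch T u p) with h | h
    · rw [h s p (hst'.trans htp) rfl] at h1
      rw [h p t rfl htp] at h2
      rw [h t q htp hpq'.symm] at h3
      exact hπ.1 s t p q hst hpq ⟨h1, h2, h3⟩
    · rw [h s p (hst'.trans htp) rfl] at h1
      rw [h p t rfl htp] at h2
      rw [h t q htp hpq'.symm] at h3
      exact hπ.1 q p t s hpq.symm hst.symm ⟨h3, h2, h1⟩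

theorem reorder_mem (hT : T.IsTree) {u : V} {σ : Equiv.Perm V} (hσ : σ u = u) (e : Finset V)
    {π : Arrangement V} (hπ : π ∈ planarAt T u) : reorder T u σ e π ∈ planarAt T u := by
  refine mem_planarAt_of_reorder hT hπ ?_ ?_ ?_
  · rw [← card_lt_pos, Finset.card_eq_zero, Finset.filter_eq_empty_iff]
    intro x _
    rw [pos_reorder_lt]
    by_cases hx : x = u
    · subst hx
      simp
    · rw [branch_self hT, if_neg (mt (branch_eq_self_iff hT).1 hx), hσ, (mem_planarAt.1 hπ).2]
      exact Nat.not_lt_zero _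
  · intro x y z hx hxz hxy hyz
    by_contra hne
    rw [pos_reorder_lt, if_neg (Ne.symm hne)] at hxy
    rw [pos_reorder_lt, if_neg (by rwa [← hxz]), ← hxz] at hyz
    omega
  · intro c
    by_cases hc : c ∈ e
    · right
      intro x y hx hy
      rw [pos_reorder_lt, if_pos (hx.trans hy.symm), if_pos (hx ▸ hc)]
    · left
      intro x y hx hy
      rw [pos_reorder_lt, if_pos (hx.trans hy.symm), if_neg (hx ▸ hc)]

/-- The original order can be read off from the new one: inside a branch by undoing the reversal,
across branches by comparing the neighbours of `u` that `σ` sends to the two given ones. -/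
theorem reorder_injOn (hT : T.IsTree) {u : V} {σ : Equiv.Perm V}
    (hσ : ∀ x, T.Adj u (σ x) ↔ T.Adj u x) (e : Finset V) :
    Set.InjOn (reorder T u σ e) (planarAt T u) := by
  have key : ∀ π ∈ planarAt T u, ∀ x y, x ≠ u → y ≠ u → (pos π x < pos π y ↔
      if branch T u x = branch T u y then
        if branch T u x ∈ e then pos (reorder T u σ e π) y < pos (reorder T u σ e π) x
        else pos (reorder T u σ e π) x < pos (reorder T u σ e π) y
      else pos (reorder T u σ e π) (σ.symm (branch T u x)) <
        pos (reorder T u σ e π) (σ.symm (branch T u y))) := by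
    intro π hπ x y hx hy
    have adjx := adj_branch hT hx
    have adjy := adj_branch hT hy
    split_ifs with h h'
    · rw [pos_reorder_lt, if_pos h.symm, ← h, if_pos h']
    · rw [pos_reorder_lt, if_pos h, if_neg h']
    · have hx' : T.Adj u (σ.symm (branch T u x)) := by rw [← hσ]; simpa using adjx
      have hy' : T.Adj u (σ.symm (branch T u y)) := by rw [← hσ]; simpa using adjy
      rw [pos_reorder_lt, branch_of_adj hT hx', branch_of_adj hT hy',
        if_neg (σ.symm.injective.ne h), σ.apply_symm_apply, σ.apply_symm_apply]
      exact pos_lt_iff_of_branch hT hπ hx adjx.ne' hy adjy.ne' (branch_of_adj hT adjx).symm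
        (branch_of_adj hT adjy).symm h
  intro π₁ h₁ π₂ h₂ heq
  rw [Finset.mem_coe] at h₁ h₂
  refine arrangement_ext fun x y => ?_
  have z1 := (mem_planarAt.1 h₁).2
  have z2 := (mem_planarAt.1 h₂).2
  by_cases hx : x = u
  · subst hx
    rw [z1, z2]
    have e1 := (pos_injective π₁).eq_iff (a := y) (b := x)
    have e2 := (pos_injective π₂).eq_iff (a := y) (b := x)
    rw [z1] at e1
    rw [z2] at e2
    rw [Nat.pos_iff_ne_zero, Nat.pos_iff_ne_zero, Ne, Ne, e1, e2]
  by_cases hy : y = u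
  · subst hy
    rw [z1, z2]
    simp
  rw [key π₁ h₁ x y hx hy, key π₂ h₂ x y hx hy, heq]

/-! ### Separation probabilities by symmetry. -/

open Classical in
-- Classify by the position of `u`. Shifts inject every class into every other one, so all classes
-- have the size of the one with `u` first.
theorem card_filter_planarArrangements [Nonempty V] (u : V) {X : Arrangement V → Prop}
    (hX : ∀ r π, X (rotate r π) ↔ X π) :
    ((planarArrangements T).filter X).card =
      Fintype.card V * ((planarAt T u).filter X).card := by
  rw [Finset.card_eq_sum_card_fiberwise (f := fun π : Arrangement V => π u)
    (t := Finset.univ) (fun _ _ => Finset.mem_coe.2 (Finset.mem_univ _))]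
  rw [Finset.sum_const_nat (m := ((planarAt T u).filter X).card), Finset.card_univ,
    Fintype.card_fin]
  intro r _
  have aux : ∀ (a b s : Fin (Fintype.card V)), a + s = b →
      (((planarArrangements T).filter X).filter fun π => π u = a).card ≤
      (((planarArrangements T).filter X).filter fun π => π u = b).card := by
    intro a b s hs
    refine Finset.card_le_card_of_injOn (rotate s) ?_ (rotate_injective s).injOn
    intro π hπ
    simp only [Finset.coe_filter, Finset.mem_filter, Set.mem_ofPred_eq] at hπ ⊢
    refine ⟨⟨rotate_mem s hπ.1.1, (hX s π).2 hπ.1.2⟩, ?_⟩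
    rw [← hs, ← hπ.2]
    rfl
  have hz : (planarAt T u).filter X =
      ((planarArrangements T).filter X).filter fun π => π u = 0 := by
    ext π
    rw [planarAt, Finset.mem_filter, Finset.mem_filter, Finset.mem_filter, Finset.mem_filter,
      and_right_comm, pos, Fin.ext_iff, Fin.val_zero]
  rw [hz]
  exact le_antisymm (aux r 0 (-r) (by simp)) (aux 0 r r (by simp))

open Classical in
-- Exchanging the branches of `x` and `z` is an injection between the two sets. Applied in both
-- directions, it yields equality.
theorem card_between_swap_le (hT : T.IsTree) {u x y z : V} (hx : T.Adj u x) (hy : T.Adj u y)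
    (hz : T.Adj u z) (hxy : x ≠ y) (hxz : x ≠ z) (hyz : y ≠ z) :
    ((planarAt T u).filter fun π => Between (pos π) x y z).card ≤
      ((planarAt T u).filter fun π => Between (pos π) z y x).card := by
  have hσu : Equiv.swap x z u = u := Equiv.swap_apply_of_ne_of_ne hx.ne hz.ne
  have hσ : ∀ w, T.Adj u (Equiv.swap x z w) ↔ T.Adj u w := by
    intro w
    rcases eq_or_ne w x with rfl | h1
    · simp [hx, hz]
    rcases eq_or_ne w z with rfl | h2
    · simp [hx, hz]
    rw [Equiv.swap_apply_of_ne_of_ne h1 h2]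
  refine Finset.card_le_card_of_injOn (reorder T u (Equiv.swap x z) ∅) ?_
    ((reorder_injOn hT hσ ∅).mono
      (Finset.coe_subset.2 (Finset.filter_subset _ _)))
  intro π hπ
  simp only [Finset.coe_filter, Set.mem_ofPred_eq] at hπ ⊢
  refine ⟨reorder_mem hT hσu ∅ hπ.1, ?_⟩
  have h := hπ.2
  unfold Between at *
  simp only [pos_reorder_lt, branch_of_adj hT hx, branch_of_adj hT hy, branch_of_adj hT hz,
    Equiv.swap_apply_left, Equiv.swap_apply_right,
    Equiv.swap_apply_of_ne_of_ne hxy.symm hyz, if_neg hxy, if_neg hxz,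
    if_neg hxy.symm, if_neg hxz.symm]
  exact h

open Classical in
-- Exactly one of the three neighbours is the middle one, and by exchange of branches each of them
-- is equally often.
theorem three_mul_card_between (hT : T.IsTree) {u x y z : V} (hx : T.Adj u x) (hy : T.Adj u y)
    (hz : T.Adj u z) (hxy : x ≠ y) (hxz : x ≠ z) (hyz : y ≠ z) :
    3 * ((planarAt T u).filter fun π => Between (pos π) x y z).card = (planarAt T u).card := by
  have hcomm : ∀ (f : V → ℕ) (a b c : V), Between f a b c ↔ Between f b a c := by
    intro f a b c
    unfold Between
    omega
  have e1 : ((planarAt T u).filter fun π => Between (pos π) x y z).card =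
      ((planarAt T u).filter fun π => Between (pos π) z y x).card :=
    le_antisymm (card_between_swap_le hT hx hy hz hxy hxz hyz)
      (card_between_swap_le hT hz hy hx hyz.symm hxz.symm hxy.symm)
  have e2 : ((planarAt T u).filter fun π => Between (pos π) x y z).card =
      ((planarAt T u).filter fun π => Between (pos π) x z y).card := by
    simp only [hcomm _ x]
    exact le_antisymm (card_between_swap_le hT hy hx hz hxy.symm hyz hxz)
      (card_between_swap_le hT hz hx hy hxz.symm hyz.symm hxy)
  have e3 : (planarAt T u).card = ((planarAt T u).filter fun π => Between (pos π) x y z).card +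
      (((planarAt T u).filter fun π => Between (pos π) z y x).card +
      ((planarAt T u).filter fun π => Between (pos π) x z y).card) := by
    rw [← Finset.card_union_of_disjoint, ← Finset.card_union_of_disjoint, ← Finset.filter_or,
      ← Finset.filter_or, Finset.filter_true_of_mem]
    · intro π _
      have := (pos_injective π).ne hxy
      have := (pos_injective π).ne hxz
      have := (pos_injective π).ne hyz
      unfold Between
      omega
    · rw [← Finset.filter_or, Finset.disjoint_filter]
      intro π _
      unfold Between
      omega
    · rw [Finset.disjoint_filter]
      intro π _
      unfold Between
      omega
  omega

open Classical in
theorem three_mul_card_separates (hT : T.IsTree) {u v a b : V} (hv : T.Adj u v) (ha : T.Adj u a)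
    (hb : T.Adj u b) (hav : a ≠ v) (hbv : b ≠ v) (hab : a ≠ b) :
    3 * ((planarArrangements T).filter fun π => Separates (pos π) u v a b).card =
      (planarArrangements T).card := by
  have : Nonempty V := ⟨u⟩
  have h1 := card_filter_planarArrangements (T := T) u (X := fun π => Separates (pos π) u v a b)
    fun r π => separates_rotate r π ha.ne hb.ne hav.symm hbv.symm
  have h2 := card_filter_planarArrangements (T := T) u (X := fun _ => True) fun _ _ => Iff.rfl
  simp only [Finset.filter_true] at h2
  rw [h1, h2, ← three_mul_card_between hT ha hb hv hab hav hbv, mul_left_comm]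
  congr 3
  -- With `u` first, being between `u` and `v` means preceding `v`; so separation of `a` from `b`
  -- says that `v` is in the middle.
  refine Finset.filter_congr fun π hπ => ?_
  have h0 := (mem_planarAt.1 hπ).2
  have := (pos_injective π).ne hav
  have := (pos_injective π).ne hbv
  have := (pos_injective π).ne ha.ne
  have := (pos_injective π).ne hb.ne
  unfold Separates Between
  omega

open Classical in
theorem two_mul_card_separates (hT : T.IsTree) {u v a b : V} (hv : T.Adj u v) (ha : T.Adj u a)
    (hb : T.Adj v b) (hav : a ≠ v) (hbu : b ≠ u) :
    2 * ((planarArrangements T).filter fun π => Separates (pos π) u v a b).card =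
      (planarArrangements T).card := by
  have : Nonempty V := ⟨u⟩
  have h1 := card_filter_planarArrangements (T := T) u (X := fun π => Separates (pos π) u v a b)
    fun r π => separates_rotate r π ha.ne hbu.symm hav.symm hb.ne
  have h2 := card_filter_planarArrangements (T := T) u (X := fun _ => True) fun _ _ => Iff.rfl
  simp only [Finset.filter_true] at h2
  have hbv : branch T u b = v := by
    rw [branch_eq_iff_branch_ne hT hv, branch_of_adj hT hb]
    exact hbu
  -- Reversing the branch of `v`, which contains `b`, changes the order of `b` and `v`, while `a`
  -- stays on its side of `v`.
  have hflip : ∀ π ∈ planarAt T u, (Separates (pos (reorder T u 1 {v} π)) u v a b ↔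
      ¬ Separates (pos π) u v a b) := by
    intro π hπ
    have h0 := (mem_planarAt.1 hπ).2
    have h0' := (mem_planarAt.1 (reorder_mem hT (σ := 1) rfl {v} hπ)).2
    have := (pos_injective π).ne hav
    have := (pos_injective π).ne hb.ne
    have := (pos_injective π).ne ha.ne
    have := (pos_injective π).ne hbu
    have := (pos_injective (reorder T u 1 {v} π)).ne ha.ne
    have := (pos_injective (reorder T u 1 {v} π)).ne hbu
    have e1 := pos_reorder_lt (T := T) u 1 {v} π a v
    have e2 := pos_reorder_lt (T := T) u 1 {v} π b v
    rw [branch_of_adj hT ha, branch_of_adj hT hv, if_neg hav] at e1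
    rw [hbv, branch_of_adj hT hv, if_pos rfl, if_pos (Finset.mem_singleton_self v)] at e2
    simp only [Equiv.Perm.coe_one, id] at e1
    unfold Separates Between
    omega
  have hinj : Set.InjOn (reorder T u 1 {v}) (planarAt T u) :=
    reorder_injOn hT (fun _ => Iff.rfl) _
  have l1 : ((planarAt T u).filter fun π => Separates (pos π) u v a b).card ≤
      ((planarAt T u).filter fun π => ¬ Separates (pos π) u v a b).card := by
    refine Finset.card_le_card_of_injOn (reorder T u 1 {v}) ?_ (hinj.mono
      (Finset.coe_subset.2 (Finset.filter_subset _ _)))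
    intro π hπ
    simp only [Finset.coe_filter, Set.mem_ofPred_eq] at hπ ⊢
    exact ⟨reorder_mem hT rfl _ hπ.1, fun h => (hflip π hπ.1).1 h hπ.2⟩
  have l2 : ((planarAt T u).filter fun π => ¬ Separates (pos π) u v a b).card ≤
      ((planarAt T u).filter fun π => Separates (pos π) u v a b).card := by
    refine Finset.card_le_card_of_injOn (reorder T u 1 {v}) ?_ (hinj.mono
      (Finset.coe_subset.2 (Finset.filter_subset _ _)))
    intro π hπ
    simp only [Finset.coe_filter, Set.mem_ofPred_eq] at hπ ⊢
    exact ⟨reorder_mem hT rfl _ hπ.1, (hflip π hπ.1).2 hπ.2⟩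
  have h3 := Finset.card_filter_add_card_filter_not (s := planarAt T u)
    (fun π => Separates (pos π) u v a b)
  rw [h1, h2, ← h3, mul_left_comm]
  congr 1
  omega

end PlanarLin

/-! ### The expected sum of edge lengths -/

namespace PlanarLin

section Rotation

/-- For the `q - p` shifts in `[n - q, n - p)` the position `q` wraps around but `p` does not, and
the distance becomes `n - (q - p)`; for the others it stays `q - p`. -/
theorem sum_abs_sub_rotate {n p q : ℕ} (hpq : p < q) (hq : q < n) :
    ∑ r : Fin n, |(((if p + r < n then p + r else p + r - n : ℕ) : ℚ)) -
        ((if q + r < n then q + r else q + r - n : ℕ) : ℚ)| =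
      2 * ((q : ℚ) - p) * (n - ((q : ℚ) - p)) := by
  rw [Fin.sum_univ_eq_sum_range (fun r => |(((if p + r < n then p + r else p + r - n : ℕ) : ℚ)) -
        ((if q + r < n then q + r else q + r - n : ℕ) : ℚ)|) n]
  have hterm : ∀ r ∈ Finset.range n,
      |(((if p + r < n then p + r else p + r - n : ℕ) : ℚ)) -
        ((if q + r < n then q + r else q + r - n : ℕ) : ℚ)| =
      ((q : ℚ) - p) + if r ∈ Finset.Ico (n - q) (n - p) then (n : ℚ) - 2 * (q - p) else 0 := by
    intro r hr
    rw [Finset.mem_range] at hr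
    have hpq' : (p : ℚ) < q := by exact_mod_cast hpq
    have hq' : (q : ℚ) < n := by exact_mod_cast hq
    have hp' : (0 : ℚ) ≤ p := by positivity
    simp only [Finset.mem_Ico]
    by_cases h1 : p + r < n
    · by_cases h2 : q + r < n
      · rw [if_pos h1, if_pos h2, if_neg (by omega)]
        push_cast
        rw [abs_of_neg (by linarith)]
        ring
      · rw [if_pos h1, if_neg h2, if_pos (by omega), Nat.cast_sub (by omega)]
        push_cast
        rw [abs_of_pos (by linarith)]
        ring
    · rw [if_neg h1, if_neg (by omega), if_neg (by omega), Nat.cast_sub (by omega),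
        Nat.cast_sub (by omega)]
      push_cast
      rw [abs_of_neg (by linarith)]
      ring
  rw [Finset.sum_congr rfl hterm, Finset.sum_add_distrib, Finset.sum_const, Finset.card_range,
    ← Finset.sum_filter, Finset.sum_const]
  have hfilter : (Finset.range n).filter (fun r => r ∈ Finset.Ico (n - q) (n - p)) =
      Finset.Ico (n - q) (n - p) := by
    ext r
    simp only [Finset.mem_filter, Finset.mem_range, Finset.mem_Ico]
    omega
  rw [hfilter, Nat.card_Ico, show n - p - (n - q) = q - p by omega, nsmul_eq_mul, nsmul_eq_mul,
    Nat.cast_sub hpq.le]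
  ring

variable {V : Type*} [Fintype V]

theorem sum_edgeLength_rotate [Nonempty V] (π : Arrangement V) (u v : V) :
    ∑ r, edgeLength (rotate r π) s(u, v) =
      2 * edgeLength π s(u, v) * (Fintype.card V - edgeLength π s(u, v)) := by
  have hdef : ∀ ρ : Arrangement V, edgeLength ρ s(u, v) = |(pos ρ u : ℚ) - pos ρ v| :=
    fun _ => rfl
  simp only [hdef, pos_rotate]
  rcases lt_trichotomy (pos π u) (pos π v) with h | h | h
  · have h' : (pos π u : ℚ) < pos π v := by exact_mod_cast h
    rw [sum_abs_sub_rotate h (pos_lt π v), abs_of_neg (by linarith)]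
    ring
  · simp [h]
  · have h' : (pos π v : ℚ) < pos π u := by exact_mod_cast h
    simp only [abs_sub_comm (_ : ℚ) ((if pos π v + _ < _ then _ else _ : ℕ) : ℚ)]
    rw [sum_abs_sub_rotate h (pos_lt π u), abs_of_pos (by linarith)]

/-- Each shift permutes the planar arrangements, so averaging over the shifts first does not change
the total. -/
theorem card_mul_sum_edgeLength [Nonempty V] [DecidableEq V] (T : SimpleGraph V)
    [DecidableRel T.Adj] (u v : V) :
    Fintype.card V * ∑ π ∈ planarArrangements T, edgeLength π s(u, v) =
      ∑ π ∈ planarArrangements T,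
        2 * edgeLength π s(u, v) * (Fintype.card V - edgeLength π s(u, v)) := by
  simp only [← sum_edgeLength_rotate]
  rw [Finset.sum_comm]
  have hr : ∀ r, ∑ π ∈ planarArrangements T, edgeLength (rotate r π) s(u, v) =
      ∑ π ∈ planarArrangements T, edgeLength π s(u, v) := by
    intro r
    have himage : (planarArrangements T).image (rotate r) = planarArrangements T := by
      refine Finset.eq_of_subset_of_card_le ?_ ?_
      · intro π hπ
        obtain ⟨ρ, hρ, rfl⟩ := Finset.mem_image.1 hπ
        exact rotate_mem r hρ
      · rw [Finset.card_image_of_injective _ (rotate_injective r)]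
    conv_rhs => rw [← himage]
    rw [Finset.sum_image (rotate_injective r).injOn]
  simp only [hr, Finset.sum_const, Finset.card_univ, Fintype.card_fin, nsmul_eq_mul]

end Rotation

/-! ### Edge lengths in terms of separated branches. -/

open Classical in
/-- The indicator of being strictly between `u` and `v`. -/
noncomputable def betweenInd {V : Type*} (f : V → ℕ) (u v c : V) : ℚ :=
  if Between f u v c then 1 else 0

theorem betweenInd_comm {V : Type*} (f : V → ℕ) (u v c : V) :
    betweenInd f u v c = betweenInd f v u c := by
  have h : Between f u v c ↔ Between f v u c := or_comm
  classical
  rw [betweenInd, betweenInd]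
  exact if_congr h rfl rfl

open Classical in
-- For `x`, `y` in `{0, 1}`, the polynomial `x + y - 2xy` is the exclusive or.
theorem betweenInd_separates {V : Type*} (f : V → ℕ) (u v a b : V) :
    betweenInd f u v a + betweenInd f u v b - 2 * betweenInd f u v a * betweenInd f u v b =
      if Separates f u v a b then 1 else 0 := by
  unfold betweenInd Separates
  by_cases h1 : Between f u v a <;> by_cases h2 : Between f u v b <;> simp [h1, h2]
  norm_num

variable {V : Type*} [Fintype V] [DecidableEq V] {T : SimpleGraph V} [DecidableRel T.Adj]

theorem edgeLength_eq {V : Type*} [Fintype V] (π : Arrangement V) {u v : V} (huv : u ≠ v) :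
    edgeLength π s(u, v) = 1 + ∑ w, betweenInd (pos π) u v w := by
  classical
  have key : ∀ u v : V, pos π u < pos π v →
      |(pos π u : ℚ) - pos π v| = 1 + ∑ w, betweenInd (pos π) u v w := by
    intro u v h
    have h' : (pos π u : ℚ) < pos π v := by exact_mod_cast h
    unfold betweenInd
    rw [Finset.sum_boole]
    have hmap : (Finset.univ.filter fun w => Between (pos π) u v w).map π.toEmbedding =
        Finset.Ioo (π u) (π v) := by
      ext i
      rw [Finset.mem_map, Finset.mem_Ioo]
      constructor
      · rintro ⟨w, hw, rfl⟩
        have hw' : Between (pos π) u v w := (Finset.mem_filter.1 hw).2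
        rcases hw' with hw' | hw'
        · exact hw'
        · omega
      · intro hi
        refine ⟨π.symm i, Finset.mem_filter.2 ⟨Finset.mem_univ _, Or.inl ?_⟩, by simp⟩
        simpa [pos] using hi
    rw [← Finset.card_map π.toEmbedding, hmap, Fin.card_Ioo, abs_of_neg (by linarith)]
    change _ = 1 + ((pos π v - pos π u - 1 : ℕ) : ℚ)
    rw [Nat.cast_sub (by omega), Nat.cast_sub h.le]
    push_cast
    ring
  change |(pos π u : ℚ) - pos π v| = _
  rcases lt_or_gt_of_ne ((pos_injective π).ne huv) with h | h
  · exact key u v h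
  · rw [abs_sub_comm, key v u h]
    congr 1
    exact Finset.sum_congr rfl fun w _ => betweenInd_comm _ _ _ _

/-- A sum over the vertices, split along the two ends of an edge, for a function that is
constant on the branches that remain. -/
theorem sum_sides (hT : T.IsTree) {u v : V} (h : T.Adj u v) {g : V → ℚ} (hu : g u = 0)
    (hv : g v = 0) (hgu : ∀ w, w ≠ u → branch T u w ≠ v → g w = g (branch T u w))
    (hgv : ∀ w, w ≠ v → branch T v w ≠ u → g w = g (branch T v w)) :
    ∑ w, g w = ∑ c ∈ (T.neighborFinset u).erase v, (subtreeSize T u c : ℚ) * g c +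
      ∑ c ∈ (T.neighborFinset v).erase u, (subtreeSize T v c : ℚ) * g c := by
  have half : ∀ {u v : V}, T.Adj u v → g u = 0 →
      (∀ w, w ≠ u → branch T u w ≠ v → g w = g (branch T u w)) →
      ∑ w, g w = ∑ w with branch T u w = v, g w +
        ∑ c ∈ (T.neighborFinset u).erase v, (subtreeSize T u c : ℚ) * g c := by
    intro u v h hu hg
    rw [sum_branches hT u g, hu, zero_add,
      ← Finset.add_sum_erase _ _ ((T.mem_neighborFinset u v).2 h)]
    congr 1
    refine Finset.sum_congr rfl fun c hc => ?_
    rw [Finset.mem_erase, SimpleGraph.mem_neighborFinset] at hc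
    rw [subtreeSize_eq_card hT hc.2, ← nsmul_eq_mul, ← Finset.sum_const]
    refine Finset.sum_congr rfl fun w hw => ?_
    have hw' : branch T u w = c := (Finset.mem_filter.1 hw).2
    rw [hg w ?_ (hw' ▸ hc.1), hw']
    rintro rfl
    rw [branch_self hT] at hw'
    exact hc.2.ne hw'
  have e1 := half h hu hgu
  have e2 := half h.symm hv hgv
  have e3 := Finset.sum_filter_add_sum_filter_not Finset.univ (fun w => branch T u w = v) g
  have e4 : ∑ w with ¬ branch T u w = v, g w = ∑ w with branch T v w = u, g w := by
    refine Finset.sum_congr ?_ fun _ _ => rfl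
    ext w
    simp [branch_eq_iff_branch_ne hT h w]
  rw [e4] at e3
  linarith

/-- On a branch at `u` that does not contain `v`, all vertices are on the same side of `uv`. -/
theorem betweenInd_branch (hT : T.IsTree) {u v : V} (h : T.Adj u v) {π : Arrangement V}
    (hπ : π ∈ planarArrangements T) {w : V} (hw : w ≠ u) (hwv : branch T u w ≠ v) :
    betweenInd (pos π) u v w = betweenInd (pos π) u v (branch T u w) := by
  have key := (mem_planarArrangements.1 hπ).between_iff_of_connIn (pos_injective π) h
    (S := {x | branch T u x = branch T u w}) ?_ ?_ (connIn_branch hT hw)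
  · classical
    rw [betweenInd, betweenInd]
    exact (if_congr key rfl rfl).symm
  · intro hm
    have hm' : branch T u u = branch T u w := hm
    rw [branch_self hT] at hm'
    exact hw ((branch_eq_self_iff hT).1 hm'.symm)
  · intro hm
    have hm' : branch T u v = branch T u w := hm
    rw [branch_of_adj hT h] at hm'
    exact hwv hm'.symm

theorem edgeLength_eq_of_planar (hT : T.IsTree) {u v : V} (h : T.Adj u v) {π : Arrangement V}
    (hπ : π ∈ planarArrangements T) :
    edgeLength π s(u, v) = 1 +
      (∑ c ∈ (T.neighborFinset u).erase v, (subtreeSize T u c : ℚ) * betweenInd (pos π) u v c +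
      ∑ c ∈ (T.neighborFinset v).erase u, (subtreeSize T v c : ℚ) * betweenInd (pos π) u v c) := by
  rw [edgeLength_eq π h.ne, sum_sides hT h]
  · simp [betweenInd, Between]
  · simp [betweenInd, Between]
  · exact fun w hw hwv => betweenInd_branch hT h hπ hw hwv
  · intro w hw hwu
    rw [betweenInd_comm, betweenInd_comm _ u v]
    exact betweenInd_branch hT h.symm hπ hw hwu

theorem sum_erase_subtreeSize (hT : T.IsTree) {u v : V} (h : T.Adj u v) :
    ∑ c ∈ (T.neighborFinset u).erase v, (subtreeSize T u c : ℚ) = subtreeSize T v u - 1 := by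
  have h1 := sum_subtreeSize hT u
  have h2 := subtreeSize_add hT h
  rw [← Finset.add_sum_erase _ _ ((T.mem_neighborFinset u v).2 h)] at h1
  have h3 : (∑ c ∈ (T.neighborFinset u).erase v, subtreeSize T u c) + 1 = subtreeSize T v u := by
    omega
  rw [← h3]
  push_cast
  ring

/-- The product of the two complementary weighted sums of indicators, as a sum over pairs. -/
theorem two_mul_sum_mul_sum {ι : Type*} (I J : Finset ι) (a b y : ι → ℚ) :
    2 * ((∑ i ∈ I, a i * y i + ∑ j ∈ J, b j * y j) *
      (∑ i ∈ I, a i * (1 - y i) + ∑ j ∈ J, b j * (1 - y j))) =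
    ∑ i ∈ I, ∑ j ∈ I, a i * a j * (y i + y j - 2 * y i * y j) +
    ∑ i ∈ J, ∑ j ∈ J, b i * b j * (y i + y j - 2 * y i * y j) +
    2 * ∑ i ∈ I, ∑ j ∈ J, a i * b j * (y i + y j - 2 * y i * y j) := by
  have expand : ∀ (I J : Finset ι) (a b : ι → ℚ),
      ∑ i ∈ I, ∑ j ∈ J, a i * b j * (y i + y j - 2 * y i * y j) =
      (∑ i ∈ I, a i * y i) * (∑ j ∈ J, b j * (1 - y j)) +
      (∑ i ∈ I, a i * (1 - y i)) * (∑ j ∈ J, b j * y j) := by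
    -- The polynomial also equals `y i * (1 - y j) + (1 - y i) * y j`, which factors the double sum.
    intro I J a b
    rw [Finset.sum_mul_sum, Finset.sum_mul_sum, ← Finset.sum_add_distrib]
    refine Finset.sum_congr rfl fun i _ => ?_
    rw [← Finset.sum_add_distrib]
    refine Finset.sum_congr rfl fun j _ => ?_
    ring
  rw [expand, expand, expand]
  ring

open Classical in
theorem sum_separates (u v a b : V) :
    ∑ π ∈ planarArrangements T, (betweenInd (pos π) u v a + betweenInd (pos π) u v b -
      2 * betweenInd (pos π) u v a * betweenInd (pos π) u v b) =
    ((planarArrangements T).filter fun π => Separates (pos π) u v a b).card := by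
  simp only [betweenInd_separates, Finset.sum_boole]

/-- The sum of the squares of the sizes of the branches at `u`. -/
noncomputable def sumSq (T : SimpleGraph V) [DecidableRel T.Adj] (u : V) : ℚ :=
  ∑ c ∈ T.neighborFinset u, (subtreeSize T u c : ℚ) ^ 2

theorem sum_pairs_same_end (hT : T.IsTree) {u v : V} (h : T.Adj u v) :
    ∑ π ∈ planarArrangements T, ∑ a ∈ (T.neighborFinset u).erase v,
      ∑ b ∈ (T.neighborFinset u).erase v, (subtreeSize T u a : ℚ) * subtreeSize T u b *
        (betweenInd (pos π) u v a + betweenInd (pos π) u v b -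
          2 * betweenInd (pos π) u v a * betweenInd (pos π) u v b) =
    (planarArrangements T).card / 3 * (((subtreeSize T v u : ℚ) - 1) ^ 2 -
      (sumSq T u - (subtreeSize T u v : ℚ) ^ 2)) := by
  classical
  have hsq : sumSq T u - (subtreeSize T u v : ℚ) ^ 2 =
      ∑ a ∈ (T.neighborFinset u).erase v, (subtreeSize T u a : ℚ) ^ 2 := by
    rw [sumSq, ← Finset.add_sum_erase _ _ ((T.mem_neighborFinset u v).2 h)]
    ring
  rw [hsq, ← sum_erase_subtreeSize hT h, sq, Finset.sum_mul_sum, ← Finset.sum_sub_distrib,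
    Finset.mul_sum, Finset.sum_comm]
  refine Finset.sum_congr rfl fun a ha => ?_
  rw [Finset.sum_comm, ← Finset.add_sum_erase _ _ ha,
    ← Finset.add_sum_erase _ (fun b => (subtreeSize T u a : ℚ) * subtreeSize T u b) ha]
  rw [Finset.mem_erase, SimpleGraph.mem_neighborFinset] at ha
  -- A branch is never separated from itself; the missing diagonal is the reason why sums of squares
  -- enter the formula.
  have hzero : ∑ π ∈ planarArrangements T, (subtreeSize T u a : ℚ) * subtreeSize T u a *
        (betweenInd (pos π) u v a + betweenInd (pos π) u v a -
          2 * betweenInd (pos π) u v a * betweenInd (pos π) u v a) = 0 := by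
    rw [← Finset.mul_sum, sum_separates]
    simp [Separates]
  rw [hzero, zero_add, sq, add_sub_cancel_left, Finset.mul_sum]
  refine Finset.sum_congr rfl fun b hb => ?_
  rw [Finset.mem_erase, Finset.mem_erase, SimpleGraph.mem_neighborFinset] at hb
  rw [← Finset.mul_sum, sum_separates,
    ← three_mul_card_separates hT h ha.2 hb.2.2 ha.1 hb.2.1 hb.1.symm]
  push_cast
  ring

theorem sum_pairs_other_end (hT : T.IsTree) {u v : V} (h : T.Adj u v) :
    ∑ π ∈ planarArrangements T, ∑ a ∈ (T.neighborFinset u).erase v,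
      ∑ b ∈ (T.neighborFinset v).erase u, (subtreeSize T u a : ℚ) * subtreeSize T v b *
        (betweenInd (pos π) u v a + betweenInd (pos π) u v b -
          2 * betweenInd (pos π) u v a * betweenInd (pos π) u v b) =
    (planarArrangements T).card / 2 * (((subtreeSize T v u : ℚ) - 1) *
      ((subtreeSize T u v : ℚ) - 1)) := by
  classical
  rw [← sum_erase_subtreeSize hT h, ← sum_erase_subtreeSize hT h.symm, Finset.sum_mul_sum,
    Finset.mul_sum, Finset.sum_comm]
  refine Finset.sum_congr rfl fun a ha => ?_
  rw [Finset.sum_comm, Finset.mul_sum]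
  refine Finset.sum_congr rfl fun b hb => ?_
  rw [Finset.mem_erase, SimpleGraph.mem_neighborFinset] at ha hb
  rw [← Finset.mul_sum, sum_separates, ← two_mul_card_separates hT h ha.2 hb.2 ha.1 hb.1]
  push_cast
  ring

/-- The total length of an edge over all planar arrangements. -/
theorem sum_edgeLength_eq (hT : T.IsTree) {u v : V} (h : T.Adj u v) :
    Fintype.card V * ∑ π ∈ planarArrangements T, edgeLength π s(u, v) =
      (planarArrangements T).card * 2 *
        ((3 * (Fintype.card V : ℚ) ^ 2 + 2 * Fintype.card V - 2) / 12 +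
          ((subtreeSize T u v : ℚ) ^ 2 + (subtreeSize T v u : ℚ) ^ 2) / 12 -
          (sumSq T u + sumSq T v) / 6) := by
  have : Nonempty V := ⟨u⟩
  rw [card_mul_sum_edgeLength]
  have hn : (Fintype.card V : ℚ) = subtreeSize T u v + subtreeSize T v u := by
    exact_mod_cast (subtreeSize_add hT h).symm
  -- This is `2ℓ(n - ℓ) = 2(n - 1) + 2AA'`, where `A` and `A'` are the weighted sums of the
  -- indicators and of their complements.
  have hterm : ∀ π ∈ planarArrangements T,
      2 * edgeLength π s(u, v) * (Fintype.card V - edgeLength π s(u, v)) =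
      2 * ((Fintype.card V : ℚ) - 1) +
      (∑ a ∈ (T.neighborFinset u).erase v,
        ∑ b ∈ (T.neighborFinset u).erase v, (subtreeSize T u a : ℚ) * subtreeSize T u b *
          (betweenInd (pos π) u v a + betweenInd (pos π) u v b -
            2 * betweenInd (pos π) u v a * betweenInd (pos π) u v b) +
      ∑ a ∈ (T.neighborFinset v).erase u,
        ∑ b ∈ (T.neighborFinset v).erase u, (subtreeSize T v a : ℚ) * subtreeSize T v b *
          (betweenInd (pos π) u v a + betweenInd (pos π) u v b -
            2 * betweenInd (pos π) u v a * betweenInd (pos π) u v b) +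
      2 * ∑ a ∈ (T.neighborFinset u).erase v,
        ∑ b ∈ (T.neighborFinset v).erase u, (subtreeSize T u a : ℚ) * subtreeSize T v b *
          (betweenInd (pos π) u v a + betweenInd (pos π) u v b -
            2 * betweenInd (pos π) u v a * betweenInd (pos π) u v b)) := by
    intro π hπ
    rw [← two_mul_sum_mul_sum]
    simp only [mul_sub, mul_one, Finset.sum_sub_distrib]
    rw [sum_erase_subtreeSize hT h, sum_erase_subtreeSize hT h.symm,
      edgeLength_eq_of_planar hT h hπ, hn]
    ring
  have hvv := sum_pairs_same_end hT h.symm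
  simp only [betweenInd_comm _ v u] at hvv
  rw [Finset.sum_congr rfl hterm, Finset.sum_add_distrib, Finset.sum_add_distrib,
    Finset.sum_add_distrib, sum_pairs_same_end hT h, hvv, Finset.sum_const, nsmul_eq_mul,
    ← Finset.mul_sum, sum_pairs_other_end hT h, hn]
  ring

theorem two_mul_sum_edgeFinset {R : Type*} [CommSemiring R] (T : SimpleGraph V)
    [DecidableRel T.Adj] (g : Sym2 V → R) :
    2 * ∑ e ∈ T.edgeFinset, g e = ∑ u, ∑ v ∈ T.neighborFinset u, g s(u, v) := by
  have h1 : ∑ u, ∑ v ∈ T.neighborFinset u, g s(u, v) =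
      ∑ p ∈ (Finset.univ : Finset (V × V)) with T.Adj p.1 p.2, g s(p.1, p.2) := by
    rw [Finset.sum_filter, Fintype.sum_prod_type]
    refine Finset.sum_congr rfl fun u _ => ?_
    rw [← Finset.sum_filter]
    refine Finset.sum_congr ?_ fun _ _ => rfl
    ext v
    simp
  rw [h1, ← Finset.sum_fiberwise_of_maps_to (t := T.edgeFinset)
    (g := fun p : V × V => s(p.1, p.2)) (fun p hp => by simpa using hp), Finset.mul_sum]
  refine Finset.sum_congr rfl fun e he => ?_
  induction e using Sym2.ind with
  | _ a b =>
    rw [SimpleGraph.mem_edgeFinset, SimpleGraph.mem_edgeSet] at he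
    have : ((Finset.univ : Finset (V × V)).filter fun p => T.Adj p.1 p.2).filter
        (fun p => s(p.1, p.2) = s(a, b)) = {(a, b), (b, a)} := by
      ext ⟨x, y⟩
      simp only [Finset.mem_filter, Finset.mem_univ, true_and, Sym2.eq_iff, Finset.mem_insert,
        Finset.mem_singleton, Prod.mk.injEq]
      refine and_iff_right_of_imp ?_
      rintro (⟨rfl, rfl⟩ | ⟨rfl, rfl⟩)
      exacts [he, he.symm]
    rw [this, Finset.sum_pair (by simpa using fun hab _ => he.ne hab), Sym2.eq_swap (a := b)]
    ring

/-- The closed formula for the expected sum of edge lengths. -/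
theorem expectedPlanarD_eq (hT : T.IsTree) {n : ℕ} (hn : Fintype.card V = n) :
    expectedPlanarD T =
      ((n : ℚ) - 1) * (3 * (n : ℚ) ^ 2 + 2 * (n : ℚ) - 2) / (6 * (n : ℚ)) -
        1 / (6 * (n : ℚ)) *
          ∑ v : V, (2 * (T.degree v : ℚ) - 1) *
            ∑ u ∈ T.neighborFinset v, (subtreeSize T v u : ℚ) ^ 2 := by
  subst hn
  have : Nonempty V := hT.1.nonempty
  have hV : (Fintype.card V : ℚ) ≠ 0 := by exact_mod_cast Fintype.card_ne_zero
  have hP : ((planarArrangements T).card : ℚ) ≠ 0 := by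
    exact_mod_cast (Finset.card_pos.2 (planarArrangements_nonempty hT)).ne'
  have hdeg : ∑ v, (T.degree v : ℚ) = 2 * ((Fintype.card V : ℚ) - 1) := by
    have h1 := T.sum_degrees_eq_twice_card_edges
    have h2 := hT.card_edgeFinset
    have h3 : ∑ v, T.degree v + 2 = 2 * Fintype.card V := by omega
    have h4 : (∑ v, (T.degree v : ℚ)) + 2 = 2 * Fintype.card V := by exact_mod_cast h3
    linarith
  -- Symmetry of ordered adjacent pairs collects the terms by vertex: the squared sizes give `2 /
  -- 12` and the terms `sumSq` of both ends give `-2 * degree / 6` times `sumSq`, together `-(2 *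
  -- degree - 1) / 6`.
  have swap : ∀ F : V → V → ℚ, ∑ u, ∑ v ∈ T.neighborFinset u, F u v =
      ∑ u, ∑ v ∈ T.neighborFinset u, F v u := by
    intro F
    exact Finset.sum_comm' fun x y => by simp [T.adj_comm]
  have hD : 2 * (Fintype.card V * ∑ π ∈ planarArrangements T, sumEdgeLengths T π) =
      (planarArrangements T).card * 2 *
        (2 * ((Fintype.card V : ℚ) - 1) *
          ((3 * (Fintype.card V : ℚ) ^ 2 + 2 * Fintype.card V - 2) / 12) -
        (∑ v, (2 * (T.degree v : ℚ) - 1) * sumSq T v) / 6) := by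
    unfold sumEdgeLengths
    rw [Finset.sum_comm, Finset.mul_sum, two_mul_sum_edgeFinset]
    have hedge : ∀ u, ∀ v ∈ T.neighborFinset u,
        Fintype.card V * ∑ π ∈ planarArrangements T, edgeLength π s(u, v) = _ :=
      fun u v hv => sum_edgeLength_eq hT ((T.mem_neighborFinset u v).1 hv)
    rw [Finset.sum_congr rfl fun u _ => Finset.sum_congr rfl (hedge u)]
    simp only [← Finset.mul_sum]
    congr 1
    generalize (3 * (Fintype.card V : ℚ) ^ 2 + 2 * Fintype.card V - 2) / 12 = C
    simp only [Finset.sum_add_distrib, Finset.sum_sub_distrib, ← Finset.sum_div,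
      Finset.sum_const, SimpleGraph.card_neighborFinset_eq_degree, nsmul_eq_mul]
    rw [swap fun u v => (subtreeSize T v u : ℚ) ^ 2, swap fun u v => sumSq T v]
    simp only [Finset.sum_const, SimpleGraph.card_neighborFinset_eq_degree, nsmul_eq_mul]
    have hs : ∀ u, ∑ v ∈ T.neighborFinset u, (subtreeSize T u v : ℚ) ^ 2 = sumSq T u :=
      fun _ => rfl
    simp only [hs, sub_mul, mul_assoc, one_mul, Finset.sum_sub_distrib]
    rw [← Finset.sum_mul, hdeg]
    simp only [← Finset.mul_sum]
    ring
  rw [expectedPlanarD, Finset.expect_eq_sum_div_card]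
  change _ = _ - _ * ∑ v : V, (2 * (T.degree v : ℚ) - 1) * sumSq T v
  field_simp
  linarith

end PlanarLin

/-! ### Straight-line code on the random access machine -/

namespace PlanarLin

/-- The program `P` leads from one configuration to the other in `k` steps, and no register
exceeds `B` meanwhile. -/
def Steps (P : List Instr) (I : List ℕ) (B : ℕ) (c : Config) (k : ℕ) (c' : Config) : Prop :=
  (step P I)^[k] c = c' ∧ ∀ j ≤ k, ∀ r, ((step P I)^[j] c).reg r ≤ B

variable {P : List Instr} {I : List ℕ} {B : ℕ}

theorem Steps.refl {c : Config} (h : ∀ r, c.reg r ≤ B) : Steps P I B c 0 c := by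
  refine ⟨rfl, fun j hj r => ?_⟩
  obtain rfl : j = 0 := by omega
  exact h r

theorem Steps.trans {c c' c'' : Config} {k l : ℕ} (h : Steps P I B c k c')
    (h' : Steps P I B c' l c'') : Steps P I B c (k + l) c'' := by
  refine ⟨by rw [Nat.add_comm, Function.iterate_add_apply, h.1, h'.1], fun j hj r => ?_⟩
  by_cases hjk : j ≤ k
  · exact h.2 j hjk r
  · obtain ⟨m, rfl⟩ := Nat.exists_eq_add_of_lt (not_le.1 hjk)
    rw [show k + m + 1 = (m + 1) + k by omega, Function.iterate_add_apply, h.1]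
    exact h'.2 _ (by omega) r

theorem Steps.reg_le {c c' : Config} {k : ℕ} (h : Steps P I B c k c') (r : ℕ) :
    c'.reg r ≤ B := by
  rw [← h.1]
  exact h.2 k le_rfl r

theorem Steps.single {c c' : Config} {i : Instr} (hi : P[c.pc]? = some i)
    (hc : ∀ r, c.reg r ≤ B) (hc' : ∀ r, c'.reg r ≤ B) (he : i.exec I c = c') :
    Steps P I B c 1 c' := by
  have hs : step P I c = c' := by
    rw [step, hi]
    exact he
  refine ⟨hs, fun j hj r => ?_⟩
  obtain rfl | rfl : j = 0 ∨ j = 1 := by omega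
  · exact hc r
  · rw [Function.iterate_one, hs]
    exact hc' r

theorem Steps.jump {pc l : ℕ} {R : ℕ → ℕ} (hi : P[pc]? = some (.jump l)) (hR : ∀ r, R r ≤ B) :
    Steps P I B ⟨pc, R⟩ 1 ⟨l, R⟩ :=
  .single hi hR hR rfl

theorem Steps.jumpZero_of_eq {pc a l : ℕ} {R : ℕ → ℕ} (hi : P[pc]? = some (.jumpZero a l))
    (hR : ∀ r, R r ≤ B) (ha : R a = 0) : Steps P I B ⟨pc, R⟩ 1 ⟨l, R⟩ :=
  .single hi hR hR (by simp [Instr.exec, ha])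

theorem Steps.jumpZero_of_ne {pc a l : ℕ} {R : ℕ → ℕ} (hi : P[pc]? = some (.jumpZero a l))
    (hR : ∀ r, R r ≤ B) (ha : R a ≠ 0) : Steps P I B ⟨pc, R⟩ 1 ⟨pc + 1, R⟩ :=
  .single hi hR hR (by simp [Instr.exec, ha])

/-- An instruction that is not a jump. -/
def Instr.IsStraight : Instr → Prop
  | .jump _ | .jumpZero _ _ => False
  | _ => True

/-- The register that the instruction writes. -/
def Instr.target (R : ℕ → ℕ) : Instr → ℕ
  | .const d _ | .add d _ _ | .sub d _ _ | .mul d _ _ | .load d _ | .read d _ => d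
  | .store a _ => R a
  | .jump _ | .jumpZero _ _ => 0

/-- The value that the instruction writes. -/
def Instr.value (I : List ℕ) (R : ℕ → ℕ) : Instr → ℕ
  | .const _ k => k
  | .add _ a b => R a + R b
  | .sub _ a b => R a - R b
  | .mul _ a b => R a * R b
  | .load _ a => R (R a)
  | .store _ b => R b
  | .read _ a => I.getD (R a) 0
  | .jump _ | .jumpZero _ _ => 0

theorem Instr.exec_of_isStraight {i : Instr} (hi : i.IsStraight) (I : List ℕ) (pc : ℕ)
    (R : ℕ → ℕ) :
    i.exec I ⟨pc, R⟩ = ⟨pc + 1, Function.update R (i.target R) (i.value I R)⟩ := by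
  cases i <;> first | rfl | exact hi.elim

/-- After the straight-line code `b`, run on the registers `R`, the registers satisfy `Q`, and
no value above `B` is written meanwhile. -/
def Wp (I : List ℕ) (B : ℕ) (Q : (ℕ → ℕ) → Prop) : List Instr → (ℕ → ℕ) → Prop
  | [], R => Q R
  | i :: b, R => i.IsStraight ∧ i.value I R ≤ B ∧
      Wp I B Q b (Function.update R (i.target R) (i.value I R))

/-- Turns symbolic execution of a block into actual steps of the program; the block is located by
`P.drop pc`, which `rfl` settles for a concrete program. -/
theorem Wp.steps {Q : (ℕ → ℕ) → Prop} {b rest : List Instr} {pc : ℕ} {R : ℕ → ℕ}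
    (hP : P.drop pc = b ++ rest) (hR : ∀ r, R r ≤ B) (h : Wp I B Q b R) :
    ∃ R', Steps P I B ⟨pc, R⟩ b.length ⟨pc + b.length, R'⟩ ∧ Q R' := by
  induction b generalizing pc R with
  | nil => exact ⟨R, .refl hR, h⟩
  | cons i b ih =>
    obtain ⟨hs, hv, hw⟩ := h
    have hi : P[pc]? = some i := by
      have := congrArg (·[0]?) hP
      simpa using this
    have hP' : P.drop (pc + 1) = b ++ rest := by
      have := congrArg List.tail hP
      simpa using this
    have hR' : ∀ r, Function.update R (i.target R) (i.value I R) r ≤ B := by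
      intro r
      rw [Function.update_apply]
      split_ifs
      exacts [hv, hR r]
    obtain ⟨R', hsteps, hQ⟩ := ih hP' hR' hw
    refine ⟨R', ?_, hQ⟩
    have h1 : Steps P I B ⟨pc, R⟩ 1 ⟨pc + 1, Function.update R (i.target R) (i.value I R)⟩ :=
      .single hi hR hR' (Instr.exec_of_isStraight hs I pc R)
    have h2 := h1.trans hsteps
    rwa [List.length_cons, show b.length + 1 = 1 + b.length by omega,
      show pc + (1 + b.length) = pc + 1 + b.length by omega]

/-! ### Memory layout. -/

/-- Registers that hold scalars below `32` and from there on four interleaved arrays. -/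
def layout (s A₀ A₁ A₂ A₃ : ℕ → ℕ) (r : ℕ) : ℕ :=
  if r < 32 then s r
  else if (r - 32) % 4 = 0 then A₀ ((r - 32) / 4)
  else if (r - 32) % 4 = 1 then A₁ ((r - 32) / 4)
  else if (r - 32) % 4 = 2 then A₂ ((r - 32) / 4)
  else A₃ ((r - 32) / 4)

section Layout

variable (s A₀ A₁ A₂ A₃ : ℕ → ℕ) (x y : ℕ)

theorem layout_of_lt {d : ℕ} (hd : d < 32) : layout s A₀ A₁ A₂ A₃ d = s d := by
  simp [layout, hd]

theorem layout_zero : layout s A₀ A₁ A₂ A₃ (x * 4 + 32) = A₀ x := by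
  simp [layout]

theorem layout_one : layout s A₀ A₁ A₂ A₃ (x * 4 + 33) = A₁ x := by
  simp [layout, show x * 4 + 33 - 32 = x * 4 + 1 by omega, show (x * 4 + 1) / 4 = x by omega,
    show ¬ x * 4 + 33 < 32 by omega, show (x * 4 + 1) % 4 = 1 by omega]

theorem layout_two : layout s A₀ A₁ A₂ A₃ (x * 4 + 34) = A₂ x := by
  simp [layout, show x * 4 + 34 - 32 = x * 4 + 2 by omega, show (x * 4 + 2) / 4 = x by omega,
    show ¬ x * 4 + 34 < 32 by omega, show (x * 4 + 2) % 4 = 2 by omega]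

theorem layout_three : layout s A₀ A₁ A₂ A₃ (x * 4 + 35) = A₃ x := by
  simp [layout, show x * 4 + 35 - 32 = x * 4 + 3 by omega, show (x * 4 + 3) / 4 = x by omega,
    show ¬ x * 4 + 35 < 32 by omega, show (x * 4 + 3) % 4 = 3 by omega]

/-- Every register is a scalar or an array cell. -/
theorem address_cases (r : ℕ) : r < 32 ∨ ∃ z, r = z * 4 + 32 ∨ r = z * 4 + 33 ∨ r = z * 4 + 34 ∨
    r = z * 4 + 35 := by
  by_cases h : r < 32
  · exact Or.inl h
  · exact Or.inr ⟨(r - 32) / 4, by omega⟩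

/-- This and the next four lemmas let a write act on one component only, so that symbolic execution
keeps the registers in the form `layout`. -/
theorem update_layout_of_lt {d : ℕ} (hd : d < 32) :
    Function.update (layout s A₀ A₁ A₂ A₃) d y = layout (Function.update s d y) A₀ A₁ A₂ A₃ := by
  ext r
  rw [Function.update_apply]
  rcases address_cases r with h | ⟨z, rfl | rfl | rfl | rfl⟩
  · simp [layout_of_lt, h, Function.update_apply]
  all_goals
    rw [if_neg (by omega)]
    simp [layout_zero, layout_one, layout_two, layout_three]

theorem update_layout_zero : Function.update (layout s A₀ A₁ A₂ A₃) (x * 4 + 32) y =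
    layout s (Function.update A₀ x y) A₁ A₂ A₃ := by
  ext r
  rw [Function.update_apply]
  rcases address_cases r with h | ⟨z, rfl | rfl | rfl | rfl⟩
  · rw [if_neg (by omega), layout_of_lt _ _ _ _ _ h, layout_of_lt _ _ _ _ _ h]
  · simp [layout_zero, Function.update_apply]
  all_goals
    rw [if_neg (by omega)]
    simp [layout_one, layout_two, layout_three]

theorem update_layout_one : Function.update (layout s A₀ A₁ A₂ A₃) (x * 4 + 33) y =
    layout s A₀ (Function.update A₁ x y) A₂ A₃ := by
  ext r
  rw [Function.update_apply]
  rcases address_cases r with h | ⟨z, rfl | rfl | rfl | rfl⟩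
  · rw [if_neg (by omega), layout_of_lt _ _ _ _ _ h, layout_of_lt _ _ _ _ _ h]
  · rw [if_neg (by omega), layout_zero, layout_zero]
  · simp [layout_one, Function.update_apply]
  all_goals
    rw [if_neg (by omega)]
    simp [layout_two, layout_three]

theorem update_layout_two : Function.update (layout s A₀ A₁ A₂ A₃) (x * 4 + 34) y =
    layout s A₀ A₁ (Function.update A₂ x y) A₃ := by
  ext r
  rw [Function.update_apply]
  rcases address_cases r with h | ⟨z, rfl | rfl | rfl | rfl⟩
  · rw [if_neg (by omega), layout_of_lt _ _ _ _ _ h, layout_of_lt _ _ _ _ _ h]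
  · rw [if_neg (by omega), layout_zero, layout_zero]
  · rw [if_neg (by omega), layout_one, layout_one]
  · simp [layout_two, Function.update_apply]
  · rw [if_neg (by omega), layout_three, layout_three]

theorem update_layout_three : Function.update (layout s A₀ A₁ A₂ A₃) (x * 4 + 35) y =
    layout s A₀ A₁ A₂ (Function.update A₃ x y) := by
  ext r
  rw [Function.update_apply]
  rcases address_cases r with h | ⟨z, rfl | rfl | rfl | rfl⟩
  · rw [if_neg (by omega), layout_of_lt _ _ _ _ _ h, layout_of_lt _ _ _ _ _ h]
  · rw [if_neg (by omega), layout_zero, layout_zero]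
  · rw [if_neg (by omega), layout_one, layout_one]
  · rw [if_neg (by omega), layout_two, layout_two]
  · simp [layout_three, Function.update_apply]

end Layout

end PlanarLin

/-! ### The program -/

namespace PlanarLin

/-- Sets up the constants, reads `n`, and sets the counter to the number of edges. -/
def initBlock : List Instr :=
  -- Register `6` is still `0` when it serves as the index in `.read 3 6`, so the head of the input
  -- is read.
  [.const 2 1, .const 4 4, .const 5 32, .read 3 6, .sub 6 3 2, .const 7 1]

/-- Reads an edge and enters it into the arrays: degrees (twice), sums of neighbours, sizes. -/
def edgeBlock : List Instr :=
  [.read 8 7, .add 7 7 2, .read 9 7, .add 7 7 2,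
    .mul 10 8 4, .add 10 10 5, .load 11 10, .add 11 11 2, .store 10 11, .add 10 10 2,
    .store 10 11, .add 10 10 2, .load 11 10, .add 11 11 9, .store 10 11, .add 10 10 2,
    .store 10 2,
    .mul 10 9 4, .add 10 10 5, .load 11 10, .add 11 11 2, .store 10 11, .add 10 10 2,
    .store 10 11, .add 10 10 2, .load 11 10, .add 11 11 8, .store 10 11, .add 10 10 2,
    .store 10 2,
    .sub 6 6 2]

/-- Looks up the degree and the current degree of the current vertex. -/
def lookupBlock : List Instr :=
  [.mul 10 13 4, .add 10 10 5, .load 16 10, .add 10 10 2, .load 15 10]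

/-- Goes on to the next vertex. -/
def nextBlock : List Instr := [.add 12 12 2, .add 13 12 0]

/-- Cuts off the current vertex, a leaf, and goes on to its neighbour. -/
def pruneBlock : List Instr :=
  [.store 10 0, .add 10 10 2, .load 17 10, .add 10 10 2, .load 18 10,
    .mul 10 17 4, .add 10 10 5, .load 19 10, .add 10 10 2, .load 15 10, .sub 15 15 2,
    .store 10 15, .add 10 10 2, .load 15 10, .sub 15 15 13, .store 10 15, .add 10 10 2,
    .load 15 10, .add 15 15 18, .store 10 15,
    .add 19 19 19, .sub 19 19 2, .mul 19 19 18, .mul 19 19 18, .add 14 14 19,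
    .sub 18 3 18, .add 16 16 16, .sub 16 16 2, .mul 16 16 18, .mul 16 16 18, .add 14 14 16,
    .add 13 17 0]

/-- Computes the numerator and the denominator. -/
def finalBlock : List Instr :=
  [.const 15 6, .mul 1 15 3, .mul 16 3 3, .const 15 3, .mul 16 16 15, .add 16 16 3, .add 16 16 3,
    .const 15 2, .sub 16 16 15, .sub 15 3 2, .mul 16 16 15, .sub 0 16 14]

/-- Reads the edges, cuts off leaves as long as there are any while adding up the contributions
of their edges, and evaluates the closed formula. -/
def program : List Instr :=
  initBlock ++ [.jumpZero 6 39] ++ edgeBlock ++ [.jump 6] ++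
  [.sub 15 3 12, .jumpZero 15 85] ++ lookupBlock ++
  [.jumpZero 15 49, .sub 11 15 2, .jumpZero 11 52] ++ nextBlock ++ [.jump 39] ++
  pruneBlock ++ [.jump 39] ++ finalBlock

/-- The scalars that hold constants. -/
structure Consts (s : ℕ → ℕ) (n : ℕ) : Prop where
  zero : s 0 = 0
  one : s 2 = 1
  size : s 3 = n
  four : s 4 = 4
  base : s 5 = 32

/-! ### Effect of the blocks. -/

variable {I : List ℕ} {B : ℕ} {Q : (ℕ → ℕ) → Prop} {s A₀ A₁ A₂ A₃ : ℕ → ℕ} {n : ℕ}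

/-- In the lemmas on blocks, the inequalities bound the values written, and `hQ` retains only the
scalars that later code uses; the scratch registers are forgotten. -/
theorem wp_initBlock (hB : 32 ≤ B) (hn : I.getD 0 0 = n) (hnB : n ≤ B)
    (hQ : ∀ s', Consts s' n → s' 6 = n - 1 → s' 7 = 1 → s' 12 = 0 → s' 13 = 0 → s' 14 = 0 →
      Q (layout s' A₀ A₁ A₂ A₃)) :
    Wp I B Q initBlock (layout (fun _ => 0) A₀ A₁ A₂ A₃) := by
  simp only [initBlock, Wp, Instr.IsStraight, Instr.value, Instr.target, true_and,
    layout_of_lt, update_layout_of_lt, Nat.reduceLT, Function.update_apply, Nat.reduceEqDiff,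
    if_true, if_false, hn]
  refine ⟨by omega, by omega, by omega, by omega, by omega, by omega, hQ _ ⟨?_, ?_, ?_, ?_, ?_⟩
    ?_ ?_ ?_ ?_ ?_⟩ <;> simp

theorem wp_edgeBlock {m q x y : ℕ} (hs : Consts s n) (h6 : s 6 = m + 1) (h7 : s 7 = q)
    (hx : I.getD q 0 = x) (hy : I.getD (q + 1) 0 = y) (hxy : x ≠ y)
    (hxB : x * 4 + 35 ≤ B) (hyB : y * 4 + 35 ≤ B) (hqB : q + 2 ≤ B) (hmB : m ≤ B)
    (h0x : A₀ x + 1 ≤ B) (h0y : A₀ y + 1 ≤ B) (h2x : A₂ x + y ≤ B) (h2y : A₂ y + x ≤ B)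
    (hQ : ∀ s', Consts s' n → s' 6 = m → s' 7 = q + 2 → s' 12 = s 12 → s' 13 = s 13 →
      s' 14 = s 14 →
      Q (layout s' (Function.update (Function.update A₀ x (A₀ x + 1)) y (A₀ y + 1))
        (Function.update (Function.update A₁ x (A₀ x + 1)) y (A₀ y + 1))
        (Function.update (Function.update A₂ x (A₂ x + y)) y (A₂ y + x))
        (Function.update (Function.update A₃ x 1) y 1))) :
    Wp I B Q edgeBlock (layout s A₀ A₁ A₂ A₃) := by
  obtain ⟨c0, c2, c3, c4, c5⟩ := hs
  simp only [edgeBlock, Wp, Instr.IsStraight, Instr.value, Instr.target, true_and,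
    layout_of_lt, update_layout_of_lt, Nat.reduceLT, Function.update_apply, Nat.reduceEqDiff,
    if_true, if_false, h7, hx, hy, c2, c4, c5, add_assoc, Nat.reduceAdd, layout_zero, layout_two,
    update_layout_zero, update_layout_one, update_layout_two,
    update_layout_three, hxy.symm, h6]
  refine ⟨?_, ?_, ?_, ?_, ?_, ?_, ?_, ?_, ?_, ?_, ?_, ?_, ?_, ?_, ?_, ?_, ?_, ?_, ?_, ?_, ?_, ?_,
    ?_, ?_, ?_, ?_, ?_, ?_, ?_, ?_, ?_, hQ _ ⟨?_, ?_, ?_, ?_, ?_⟩ ?_ ?_ ?_ ?_ ?_⟩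
  all_goals first | omega | simp [*]

theorem wp_compareBlock {i : ℕ} (hs : Consts s n) (h12 : s 12 = i) (hnB : n ≤ B)
    (hQ : ∀ s', Consts s' n → s' 12 = s 12 → s' 13 = s 13 → s' 14 = s 14 → s' 15 = n - i →
      Q (layout s' A₀ A₁ A₂ A₃)) :
    Wp I B Q [.sub 15 3 12] (layout s A₀ A₁ A₂ A₃) := by
  obtain ⟨c0, c2, c3, c4, c5⟩ := hs
  simp only [Wp, Instr.IsStraight, Instr.value, Instr.target, true_and, layout_of_lt,
    update_layout_of_lt, Nat.reduceLT, h12, c3]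
  refine ⟨?_, hQ _ ⟨?_, ?_, ?_, ?_, ?_⟩ ?_ ?_ ?_ ?_⟩
  all_goals first | omega | simp [*]

theorem wp_predBlock {d : ℕ} (hs : Consts s n) (h15 : s 15 = d) (hdB : d ≤ B)
    (hQ : ∀ s', Consts s' n → s' 10 = s 10 → s' 11 = d - 1 → s' 12 = s 12 → s' 13 = s 13 →
      s' 14 = s 14 → s' 16 = s 16 → Q (layout s' A₀ A₁ A₂ A₃)) :
    Wp I B Q [.sub 11 15 2] (layout s A₀ A₁ A₂ A₃) := by
  obtain ⟨c0, c2, c3, c4, c5⟩ := hs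
  simp only [Wp, Instr.IsStraight, Instr.value, Instr.target, true_and, layout_of_lt,
    update_layout_of_lt, Nat.reduceLT, h15, c2]
  refine ⟨?_, hQ _ ⟨?_, ?_, ?_, ?_, ?_⟩ ?_ ?_ ?_ ?_ ?_ ?_⟩
  all_goals first | omega | simp [*]

theorem wp_lookupBlock {v : ℕ} (hs : Consts s n) (h13 : s 13 = v) (hvB : v * 4 + 33 ≤ B)
    (h0 : A₀ v ≤ B) (h1 : A₁ v ≤ B)
    (hQ : ∀ s', Consts s' n → s' 10 = v * 4 + 33 → s' 12 = s 12 → s' 13 = v → s' 14 = s 14 →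
      s' 15 = A₁ v → s' 16 = A₀ v → Q (layout s' A₀ A₁ A₂ A₃)) :
    Wp I B Q lookupBlock (layout s A₀ A₁ A₂ A₃) := by
  obtain ⟨c0, c2, c3, c4, c5⟩ := hs
  simp only [lookupBlock, Wp, Instr.IsStraight, Instr.value, Instr.target, true_and,
    layout_of_lt, update_layout_of_lt, Nat.reduceLT, Function.update_apply, Nat.reduceEqDiff,
    if_true, if_false, h13, c2, c4, c5, add_assoc, Nat.reduceAdd, layout_zero, layout_one]
  refine ⟨?_, ?_, ?_, ?_, ?_, hQ _ ⟨?_, ?_, ?_, ?_, ?_⟩ ?_ ?_ ?_ ?_ ?_ ?_⟩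
  all_goals first | omega | simp [*]

theorem wp_nextBlock {i : ℕ} (hs : Consts s n) (h12 : s 12 = i) (hiB : i + 1 ≤ B)
    (hQ : ∀ s', Consts s' n → s' 12 = i + 1 → s' 13 = i + 1 → s' 14 = s 14 →
      Q (layout s' A₀ A₁ A₂ A₃)) :
    Wp I B Q nextBlock (layout s A₀ A₁ A₂ A₃) := by
  obtain ⟨c0, c2, c3, c4, c5⟩ := hs
  simp only [nextBlock, Wp, Instr.IsStraight, Instr.value, Instr.target, true_and,
    layout_of_lt, update_layout_of_lt, Nat.reduceLT, Function.update_apply, Nat.reduceEqDiff,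
    if_true, if_false, h12, c0, c2, add_zero]
  refine ⟨?_, ?_, hQ _ ⟨?_, ?_, ?_, ?_, ?_⟩ ?_ ?_ ?_⟩
  all_goals first | omega | simp [*]

/-- Register `10` still points to the remaining degree of `v`, where `lookupBlock` left it. For a
leaf, `z` and `n - z` will be the two directional sizes of the edge `vp`. -/
theorem wp_pruneBlock {v p z d₀ e₀ acc : ℕ} (hs : Consts s n) (h10 : s 10 = v * 4 + 33)
    (h13 : s 13 = v) (h14 : s 14 = acc) (h16 : s 16 = d₀) (hp : A₂ v = p) (hz : A₃ v = z)
    (he : A₀ p = e₀) (hpv : p ≠ v)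
    (hvB : v * 4 + 35 ≤ B) (hpB : p * 4 + 35 ≤ B) (hzB : z ≤ B) (hnB : n ≤ B)
    (h1B : A₁ p ≤ B) (h2B : A₂ p ≤ B) (h3B : A₃ p + z ≤ B) (heB : e₀ + e₀ ≤ B)
    (hdB : d₀ + d₀ ≤ B) (hb₁ : (e₀ + e₀ - 1) * z ≤ B) (hb₂ : (e₀ + e₀ - 1) * z * z ≤ B)
    (hb₃ : (d₀ + d₀ - 1) * (n - z) ≤ B) (hb₄ : (d₀ + d₀ - 1) * (n - z) * (n - z) ≤ B)
    (haB : acc + ((e₀ + e₀ - 1) * z * z + (d₀ + d₀ - 1) * (n - z) * (n - z)) ≤ B)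
    (hQ : ∀ s', Consts s' n → s' 12 = s 12 → s' 13 = p →
      s' 14 = acc + ((e₀ + e₀ - 1) * z * z + (d₀ + d₀ - 1) * (n - z) * (n - z)) →
      Q (layout s' A₀ (Function.update (Function.update A₁ v 0) p (A₁ p - 1))
        (Function.update A₂ p (A₂ p - v)) (Function.update A₃ p (A₃ p + z)))) :
    Wp I B Q pruneBlock (layout s A₀ A₁ A₂ A₃) := by
  obtain ⟨c0, c2, c3, c4, c5⟩ := hs
  simp only [pruneBlock, Wp, Instr.IsStraight, Instr.value, Instr.target, true_and,
    layout_of_lt, update_layout_of_lt, Nat.reduceLT, Function.update_apply, Nat.reduceEqDiff,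
    if_true, if_false, h10, h13, h14, h16, hp, hz, he, c0, c2, c3, c4, c5, add_assoc,
    Nat.reduceAdd, layout_zero, layout_one, layout_two, layout_three, update_layout_one,
    update_layout_two, update_layout_three, hpv, add_zero]
  refine ⟨?_, ?_, ?_, ?_, ?_, ?_, ?_, ?_, ?_, ?_, ?_, ?_, ?_, ?_, ?_, ?_, ?_, ?_, ?_, ?_, ?_, ?_,
    ?_, ?_, ?_, ?_, ?_, ?_, ?_, ?_, ?_, ?_, hQ _ ⟨?_, ?_, ?_, ?_, ?_⟩ ?_ ?_ ?_⟩
  all_goals first | omega | simp [*]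

theorem wp_finalBlock {acc : ℕ} (hs : Consts s n) (h14 : s 14 = acc) (hB : 6 ≤ B)
    (hb : 6 * n ≤ B) (hb₁ : n * n * 3 ≤ B) (hb₂ : n * n * 3 + (n + n) ≤ B)
    (hb₃ : (n * n * 3 + (n + n) - 2) * (n - 1) ≤ B)
    (hQ : ∀ s', s' 0 = (n * n * 3 + (n + n) - 2) * (n - 1) - acc → s' 1 = 6 * n →
      Q (layout s' A₀ A₁ A₂ A₃)) :
    Wp I B Q finalBlock (layout s A₀ A₁ A₂ A₃) := by
  obtain ⟨c0, c2, c3, c4, c5⟩ := hs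
  simp only [finalBlock, Wp, Instr.IsStraight, Instr.value, Instr.target, true_and,
    layout_of_lt, update_layout_of_lt, Nat.reduceLT, Function.update_apply, Nat.reduceEqDiff,
    if_true, if_false, h14, c2, c3, add_assoc]
  refine ⟨?_, ?_, ?_, ?_, ?_, ?_, ?_, ?_, ?_, ?_, ?_, ?_, hQ _ ?_ ?_⟩
  all_goals first | omega | simp [*]

end PlanarLin

/-! ### Reading the edges -/

namespace PlanarLin

variable {n : ℕ}

/-- The sum of `g` over the vertices that `L` joins to `v`. -/
def endSum (g : Fin n → ℕ) (L : List (Fin n × Fin n)) (v : Fin n) : ℕ :=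
  (L.map fun e => (if e.1 = v then g e.2 else 0) + if e.2 = v then g e.1 else 0).sum

theorem endSum_append_singleton (g : Fin n → ℕ) (L : List (Fin n × Fin n)) (e : Fin n × Fin n)
    (v : Fin n) : endSum g (L ++ [e]) v =
      endSum g L v + ((if e.1 = v then g e.2 else 0) + if e.2 = v then g e.1 else 0) := by
  simp [endSum]

theorem endSum_le {g : Fin n → ℕ} {b : ℕ} (hg : ∀ w, g w ≤ b) (L : List (Fin n × Fin n))
    (v : Fin n) : endSum g L v ≤ 2 * b * L.length := by
  unfold endSum
  rw [mul_comm, ← smul_eq_mul, ← List.length_map (as := L)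
    (f := fun e => (if e.1 = v then g e.2 else 0) + if e.2 = v then g e.1 else 0)]
  refine List.sum_le_card_nsmul _ _ fun x hx => ?_
  obtain ⟨e, _, rfl⟩ := List.mem_map.1 hx
  have h1 := hg e.1
  have h2 := hg e.2
  split_ifs <;> omega

/-- The summand is symmetric in the ends of the edge, so the list may be replaced by the edge set,
whose double is a sum over ordered adjacent pairs. -/
theorem endSum_eq {T : SimpleGraph (Fin n)} [DecidableRel T.Adj] {L : List (Fin n × Fin n)}
    (hL : IsEdgeList T L) (g : Fin n → ℕ) (v : Fin n) :
    endSum g L v = ∑ w ∈ T.neighborFinset v, g w := by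
  let h : Sym2 (Fin n) → ℕ := Sym2.lift
    ⟨fun a b => (if a = v then g b else 0) + if b = v then g a else 0, fun _ _ => add_comm _ _⟩
  have e1 : endSum g L v = ∑ e ∈ T.edgeFinset, h e := by
    have hset : (L.map fun e => s(e.1, e.2)).toFinset = T.edgeFinset := by
      ext e
      rw [List.mem_toFinset, hL.2, SimpleGraph.mem_edgeFinset]
    rw [← hset, List.sum_toFinset _ hL.1, List.map_map]
    rfl
  have e2 := two_mul_sum_edgeFinset T h
  have e3 : ∑ u, ∑ w ∈ T.neighborFinset u, h s(u, w) =
      ∑ u, ∑ w ∈ T.neighborFinset u, (if u = v then g w else 0) +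
      ∑ u, ∑ w ∈ T.neighborFinset u, (if w = v then g u else 0) := by
    simp only [← Finset.sum_add_distrib]
    rfl
  have e4 : ∑ u, ∑ w ∈ T.neighborFinset u, (if w = v then g u else 0) =
      ∑ u, ∑ w ∈ T.neighborFinset u, (if u = v then g w else 0) :=
    Finset.sum_comm' fun x y => by simp [T.adj_comm]
  have e5 : ∑ u, ∑ w ∈ T.neighborFinset u, (if u = v then g w else 0) =
      ∑ w ∈ T.neighborFinset v, g w := by
    rw [Finset.sum_eq_single v]
    · simp
    · intro u _ hu
      simp [hu]
    · simp
  omega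

theorem IsEdgeList.length_eq {T : SimpleGraph (Fin n)} [DecidableRel T.Adj] (hT : T.IsTree)
    {L : List (Fin n × Fin n)} (hL : IsEdgeList T L) : L.length + 1 = n := by
  have hset : (L.map fun e => s(e.1, e.2)).toFinset = T.edgeFinset := by
    ext e
    rw [List.mem_toFinset, hL.2, SimpleGraph.mem_edgeFinset]
  have h := hT.card_edgeFinset
  rw [← hset, List.toFinset_card_of_nodup hL.1, List.length_map, Fintype.card_fin] at h
  exact h

theorem IsEdgeList.ne {T : SimpleGraph (Fin n)} {L : List (Fin n × Fin n)} (hL : IsEdgeList T L)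
    {e : Fin n × Fin n} (he : e ∈ L) : e.1 ≠ e.2 :=
  (show T.Adj e.1 e.2 from (hL.2 _).1 (List.mem_map_of_mem he)).ne

theorem encodeInput_getD (L₁ L₂ : List (Fin n × Fin n)) (e : Fin n × Fin n) :
    (encodeInput (L₁ ++ e :: L₂)).getD (1 + 2 * L₁.length) 0 = e.1 ∧
    (encodeInput (L₁ ++ e :: L₂)).getD (1 + 2 * L₁.length + 1) 0 = e.2 := by
  induction L₁ with
  | nil => simp [encodeInput]
  | cons d L₁ ih =>
    simp only [encodeInput, List.cons_append, List.flatMap_cons, List.length_cons,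
      List.nil_append, show 1 + 2 * (L₁.length + 1) = (1 + 2 * L₁.length) + 1 + 1 by omega,
      show ∀ k, 1 + k = k + 1 from fun k => Nat.add_comm 1 k, List.getD_cons_succ] at ih ⊢
    exact ih

/-- The state after the edges `L₁` have been read, with `m` edges left. -/
structure EdgeInv (L₁ : List (Fin n × Fin n)) (m : ℕ) (s A₀ A₁ A₂ A₃ : ℕ → ℕ) : Prop where
  consts : Consts s n
  count : s 6 = m
  pointer : s 7 = 1 + 2 * L₁.length
  index : s 12 = 0
  vertex : s 13 = 0
  acc : s 14 = 0
  degree : ∀ v : Fin n, A₀ v = endSum (fun _ => 1) L₁ v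
  current : ∀ v : Fin n, A₁ v = endSum (fun _ => 1) L₁ v
  neighbours : ∀ v : Fin n, A₂ v = endSum (fun w => w) L₁ v
  -- The cell becomes `1` only when the vertex occurs in an edge; an isolated vertex keeps `0`.
  size : ∀ v : Fin n, endSum (fun _ => 1) L₁ v ≠ 0 → A₃ v = 1

theorem update_update_endSum {x y : Fin n} (hxy : x ≠ y) {A A' : ℕ → ℕ} {g : Fin n → ℕ}
    {L : List (Fin n × Fin n)} (hA : ∀ v : Fin n, A v = endSum g L v)
    (hA' : ∀ v : Fin n, A' v = endSum g L v) (v : Fin n) :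
    Function.update (Function.update A' x (A x + g y)) y (A y + g x) v =
      endSum g (L ++ [(x, y)]) v := by
  rw [endSum_append_singleton, Function.update_apply, Function.update_apply, hA, hA, hA']
  simp only [Fin.val_inj]
  by_cases h1 : v = y
  · subst h1
    simp [hxy]
  · by_cases h2 : v = x
    · subst h2
      simp [h1, Ne.symm h1]
    · simp [h1, h2, Ne.symm h1, Ne.symm h2]

/-- Each edge costs one test, the 31 instructions of `edgeBlock` and one jump; the final `1` is the
test that leaves the loop. -/
theorem edge_loop {B : ℕ} (hB : 300 * n ^ 3 ≤ B) {L : List (Fin n × Fin n)}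
    (hne : ∀ e ∈ L, e.1 ≠ e.2) (hlen : L.length + 1 = n) (L₂ : List (Fin n × Fin n)) :
    ∀ (L₁ : List (Fin n × Fin n)) (s A₀ A₁ A₂ A₃ : ℕ → ℕ), L₁ ++ L₂ = L →
      EdgeInv L₁ L₂.length s A₀ A₁ A₂ A₃ → (∀ r, layout s A₀ A₁ A₂ A₃ r ≤ B) →
      ∃ k ≤ 33 * L₂.length + 1, ∃ s' A₀' A₁' A₂' A₃',
        Steps program (encodeInput L) B ⟨6, layout s A₀ A₁ A₂ A₃⟩ k
          ⟨39, layout s' A₀' A₁' A₂' A₃'⟩ ∧ EdgeInv L 0 s' A₀' A₁' A₂' A₃' := by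
  induction L₂ with
  | nil =>
    intro L₁ s A₀ A₁ A₂ A₃ hL hinv hR
    rw [List.append_nil] at hL
    subst hL
    refine ⟨1, by omega, s, A₀, A₁, A₂, A₃, .jumpZero_of_eq (a := 6) rfl hR ?_, hinv⟩
    rw [layout_of_lt _ _ _ _ _ (by omega), hinv.count]
    rfl
  | cons e L₂ ih =>
    intro L₁ s A₀ A₁ A₂ A₃ hL hinv hR
    obtain ⟨x, y⟩ := e
    have hxy : x ≠ y := hne (x, y) (by simp [← hL])
    have hlen' : L₁.length + L₂.length + 2 = n := by
      have h := congrArg List.length hL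
      simp only [List.length_append, List.length_cons] at h
      omega
    have hin := encodeInput_getD L₁ L₂ (x, y)
    rw [hL] at hin
    have hn1 : 1 ≤ n := by omega
    have hn2 : n ≤ n * n := Nat.le_mul_of_pos_left n hn1
    have hn3 : n * n ≤ n ^ 3 := by
      rw [pow_succ, sq]
      exact Nat.le_mul_of_pos_right _ hn1
    have hd : ∀ v : Fin n, A₀ v ≤ 2 * n := by
      intro v
      rw [hinv.degree]
      refine (endSum_le (b := 1) (fun _ => le_rfl) L₁ v).trans ?_
      omega
    have hs : ∀ v : Fin n, A₂ v ≤ 2 * (n * n) := by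
      intro v
      rw [hinv.neighbours]
      refine (endSum_le (b := n) (fun w => w.2.le) L₁ v).trans ?_
      rw [mul_assoc]
      exact Nat.mul_le_mul_left 2 (Nat.mul_le_mul_left n (by omega))
    have hx := x.2
    have hy := y.2
    have hdx := hd x
    have hdy := hd y
    have hsx := hs x
    have hsy := hs y
    have step1 : Steps program (encodeInput L) B ⟨6, layout s A₀ A₁ A₂ A₃⟩ 1
        ⟨7, layout s A₀ A₁ A₂ A₃⟩ := by
      refine .jumpZero_of_ne (a := 6) (l := 39) rfl hR ?_
      rw [layout_of_lt _ _ _ _ _ (by omega), hinv.count, List.length_cons]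
      omega
    obtain ⟨R', step2, s', rfl, c, h6, h7, h12, h13, h14⟩ := Wp.steps (P := program) (pc := 7)
      (b := edgeBlock) (rest := program.drop 38) (I := encodeInput L) (B := B)
      (Q := fun R => ∃ s', R = layout s'
        (Function.update (Function.update A₀ x (A₀ x + 1)) y (A₀ y + 1))
        (Function.update (Function.update A₁ x (A₀ x + 1)) y (A₀ y + 1))
        (Function.update (Function.update A₂ x (A₂ x + y)) y (A₂ y + x))
        (Function.update (Function.update A₃ x 1) y 1) ∧ Consts s' n ∧ s' 6 = L₂.length ∧
        s' 7 = 1 + 2 * L₁.length + 2 ∧ s' 12 = s 12 ∧ s' 13 = s 13 ∧ s' 14 = s 14)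
      rfl hR
      (wp_edgeBlock hinv.consts (hinv.count.trans List.length_cons) hinv.pointer hin.1 hin.2
        (by simpa [Fin.val_inj] using hxy) (by dsimp only; omega) (by dsimp only; omega) (by omega)
        (by omega) (by dsimp only; omega) (by dsimp only; omega) (by dsimp only; omega)
        (by dsimp only; omega)
        fun s' c h6 h7 h12 h13 h14 => ⟨s', rfl, c, h6, h7, h12, h13, h14⟩)
    have step3 : Steps program (encodeInput L) B ⟨38, _⟩ 1 ⟨6, _⟩ :=
      .jump rfl step2.reg_le
    obtain ⟨k, hk, s'', A₀', A₁', A₂', A₃', step4, hinv'⟩ := ih (L₁ ++ [(x, y)]) s' _ _ _ _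
      (by rw [← hL]; simp)
      { consts := c
        count := h6
        pointer := by rw [h7, List.length_append, List.length_singleton]; omega
        index := h12.trans hinv.index
        vertex := h13.trans hinv.vertex
        acc := h14.trans hinv.acc
        degree := update_update_endSum (g := fun _ => 1) hxy hinv.degree hinv.degree
        current := update_update_endSum (g := fun _ => 1) hxy hinv.degree hinv.current
        neighbours := update_update_endSum (g := fun w => w) hxy hinv.neighbours hinv.neighbours
        size := by
          intro v hv
          rw [endSum_append_singleton] at hv
          rw [Function.update_apply, Function.update_apply]
          simp only [Fin.val_inj]
          split_ifs with h1 h2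
          · rfl
          · rfl
          · refine hinv.size v ?_
            simpa [Ne.symm h1, Ne.symm h2] using hv }
      step3.reg_le
    refine ⟨_, ?_, s'', A₀', A₁', A₂', A₃', ((step1.trans step2).trans step3).trans step4, hinv'⟩
    rw [List.length_cons, show edgeBlock.length = 31 from rfl]
    omega

end PlanarLin

/-! ### Cutting off leaves -/

namespace PlanarLin

section Prune

variable {V : Type*} [DecidableEq V] {N : V → Finset V} {v p : V}

theorem prune_self : prune N v v = ∅ := by
  simp [prune]

theorem prune_of_ne {j : V} (hj : j ≠ v) : prune N v j = (N j).erase v := by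
  simp [prune, hj]

theorem prune_of_notMem {j : V} (hj : j ≠ v) (h : v ∉ N j) : prune N v j = N j := by
  rw [prune_of_ne hj, Finset.erase_eq_of_notMem h]

/-- Cutting off a leaf removes just the two orientations of its edge. Used for the accumulated
weights and, with `F = 1`, for the termination measure. -/
theorem sum_prune [Fintype V] (hsymm : ∀ x y, y ∈ N x → x ∈ N y) (hv : N v = {p}) (hpv : p ≠ v)
    (F : V → V → ℕ) :
    ∑ j, ∑ u ∈ prune N v j, F j u + (F p v + F v p) = ∑ j, ∑ u ∈ N j, F j u := by
  have hvp : v ∈ N p := hsymm v p (by simp [hv])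
  have e1 : F p v + F v p =
      ∑ j, ((if j = p then F p v else 0) + if j = v then F v p else 0) := by
    rw [Finset.sum_add_distrib]
    simp
  rw [e1, ← Finset.sum_add_distrib]
  refine Finset.sum_congr rfl fun j _ => ?_
  by_cases h1 : j = v
  · subst h1
    simp [prune_self, hv, hpv.symm]
  · by_cases h2 : j = p
    · subst h2
      rw [prune_of_ne h1, if_pos rfl, if_neg h1, add_zero, Finset.sum_erase_add _ _ hvp]
    · rw [prune_of_notMem h1, if_neg h1, if_neg h2, add_zero, add_zero]
      intro h
      have := hsymm j v h
      rw [hv, Finset.mem_singleton] at this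
      exact h2 this

end Prune

variable {n : ℕ}

/-- The contribution of the ordered pair `j`, `u` to the closed formula. -/
noncomputable def weight (T : SimpleGraph (Fin n)) [DecidableRel T.Adj] (j u : Fin n) : ℕ :=
  (T.degree j + T.degree j - 1) * subtreeSize T j u * subtreeSize T j u

/-- The sum that the closed formula subtracts. -/
noncomputable def totalWeight (T : SimpleGraph (Fin n)) [DecidableRel T.Adj] : ℕ :=
  ∑ j, ∑ u ∈ T.neighborFinset j, weight T j u

/-- The state while leaves are cut off: `N` lists the remaining neighbours, `i` is the vertex
that the search has reached, and `v` is the current vertex. -/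
structure PruneInv (T : SimpleGraph (Fin n)) [DecidableRel T.Adj] (N : Fin n → Finset (Fin n))
    (i v : ℕ) (s A₀ A₁ A₂ A₃ : ℕ → ℕ) : Prop where
  consts : Consts s n
  index : s 12 = i
  vertex : s 13 = v
  symm : ∀ x y, y ∈ N x → x ∈ N y
  adj : ∀ x y, y ∈ N x → T.Adj x y
  degree : ∀ j : Fin n, A₀ j = T.degree j
  current : ∀ j : Fin n, A₁ j = (N j).card
  neighbours : ∀ j : Fin n, (N j).Nonempty → A₂ j = ∑ w ∈ N j, (w : ℕ)
  -- `A₃ j` counts `j` and the branches already cut off at `j`. The cell of a vertex that has been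
  -- cut off is not updated, hence the restriction to nonempty `N j`.
  size : ∀ j : Fin n, (N j).Nonempty → A₃ j + ∑ c ∈ N j, subtreeSize T j c = n
  acc : s 14 + ∑ j, ∑ u ∈ N j, weight T j u = totalWeight T
  range : (i < n ∧ v < n) ∨ (i = n ∧ v = n)
  -- Among the vertices scanned, only the current one may be a leaf. At `i = v = n` there is no leaf
  -- at all, so no edge is left.
  leaf : ∀ j : Fin n, (j : ℕ) ≤ i → (j : ℕ) ≠ v → (N j).card ≠ 1

/-- The invariant after the leaf `v` with neighbour `p` has been cut off. -/
theorem PruneInv.prune {T : SimpleGraph (Fin n)} [DecidableRel T.Adj]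
    {N : Fin n → Finset (Fin n)} {i : ℕ} {v p : Fin n} {s s' A₀ A₁ A₂ A₃ : ℕ → ℕ}
    (hinv : PruneInv T N i v s A₀ A₁ A₂ A₃) (hv : N v = {p}) (hpv : p ≠ v) (hi : i < n)
    (hsize : A₃ v = subtreeSize T p v) (hc : Consts s' n) (h12 : s' 12 = s 12) (h13 : s' 13 = p)
    (h14 : s' 14 = s 14 + (weight T p v + weight T v p)) :
    PruneInv T (prune N v) i p s' A₀ (Function.update (Function.update A₁ v 0) p (A₁ p - 1))
      (Function.update A₂ p (A₂ p - v)) (Function.update A₃ p (A₃ p + A₃ v)) := by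
  have hvp : v ∈ N p := hinv.symm v p (by simp [hv])
  have hpN : (N p).Nonempty := ⟨v, hvp⟩
  have hother : ∀ j, j ≠ v → j ≠ p → PlanarLin.prune N v j = N j := by
    intro j h1 h2
    refine prune_of_notMem h1 fun h => ?_
    have := hinv.symm j v h
    rw [hv, Finset.mem_singleton] at this
    exact h2 this
  refine
    { consts := hc
      index := h12.trans hinv.index
      vertex := h13
      symm := fun x y h => ?_
      adj := fun x y h => hinv.adj x y (mem_prune.1 h).2.2
      degree := hinv.degree
      current := fun j => ?_
      neighbours := fun j hj => ?_
      size := fun j hj => ?_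
      acc := ?_
      range := Or.inl ⟨hi, p.2⟩
      leaf := fun j hji hjp => ?_ }
  · rw [mem_prune] at *
    exact ⟨h.2.1, h.1, hinv.symm _ _ h.2.2⟩
  · rw [Function.update_apply, Function.update_apply]
    simp only [Fin.val_inj]
    split_ifs with h1 h2
    · rw [h1, prune_of_ne hpv, Finset.card_erase_of_mem hvp, hinv.current]
    · rw [h2, prune_self, Finset.card_empty]
    · rw [hother j h2 h1, hinv.current]
  · have hjv : j ≠ v := by
      rintro rfl
      rw [prune_self] at hj
      exact Finset.not_nonempty_empty hj
    rw [Function.update_apply]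
    simp only [Fin.val_inj]
    split_ifs with h1
    · rw [h1, prune_of_ne hpv, hinv.neighbours p hpN, ← Finset.sum_erase_add _ _ hvp]
      omega
    · rw [hother j hjv h1] at hj ⊢
      exact hinv.neighbours j hj
  · have hjv : j ≠ v := by
      rintro rfl
      rw [prune_self] at hj
      exact Finset.not_nonempty_empty hj
    rw [Function.update_apply]
    simp only [Fin.val_inj]
    split_ifs with h1
    · have h := hinv.size p hpN
      rw [← Finset.sum_erase_add _ _ hvp] at h
      rw [h1, prune_of_ne hpv, hsize]
      omega
    · rw [hother j hjv h1] at hj ⊢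
      exact hinv.size j hj
  · rw [h14, ← hinv.acc, ← sum_prune hinv.symm hv hpv]
    omega
  · by_cases hjv : j = v
    · rw [hjv, prune_self]
      simp
    · rw [hother j hjv (fun h => hjp (by rw [h]))]
      exact hinv.leaf j hji fun h => hjv (Fin.ext h)

theorem PruneInv.congr {T : SimpleGraph (Fin n)} [DecidableRel T.Adj]
    {N : Fin n → Finset (Fin n)} {i v : ℕ} {s s' A₀ A₁ A₂ A₃ : ℕ → ℕ}
    (hinv : PruneInv T N i v s A₀ A₁ A₂ A₃) (hc : Consts s' n) (h12 : s' 12 = s 12)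
    (h13 : s' 13 = s 13) (h14 : s' 14 = s 14) : PruneInv T N i v s' A₀ A₁ A₂ A₃ :=
  { hinv with
    consts := hc
    index := h12.trans hinv.index
    vertex := h13.trans hinv.vertex
    acc := h14 ▸ hinv.acc }

theorem PruneInv.next {T : SimpleGraph (Fin n)} [DecidableRel T.Adj]
    {N : Fin n → Finset (Fin n)} {i : ℕ} {v : Fin n} {s s' A₀ A₁ A₂ A₃ : ℕ → ℕ}
    (hinv : PruneInv T N i v s A₀ A₁ A₂ A₃) (hv : (N v).card ≠ 1) (hi : i < n)
    (hc : Consts s' n) (h12 : s' 12 = i + 1) (h13 : s' 13 = i + 1) (h14 : s' 14 = s 14) :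
    PruneInv T N (i + 1) (i + 1) s' A₀ A₁ A₂ A₃ :=
  { hinv with
    consts := hc
    index := h12
    vertex := h13
    acc := h14 ▸ hinv.acc
    range := by omega
    leaf := fun j hj hj' => by
      by_cases hjv : j = v
      · rwa [hjv]
      · exact hinv.leaf j (by omega) fun h => hjv (Fin.ext h) }

/-- Every round either deletes an edge, lowering the sum of the remaining degrees by two, or
advances `i`. So the measure `m` drops, and a round takes fewer than 50 steps. -/
theorem prune_loop {T : SimpleGraph (Fin n)} [DecidableRel T.Adj] (hT : T.IsTree) {I : List ℕ}
    {B : ℕ} (hB : 300 * n ^ 3 ≤ B) (htotal : totalWeight T ≤ B) (m : ℕ) :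
    ∀ (N : Fin n → Finset (Fin n)) (i v : ℕ) (s A₀ A₁ A₂ A₃ : ℕ → ℕ),
      PruneInv T N i v s A₀ A₁ A₂ A₃ → (∀ r, layout s A₀ A₁ A₂ A₃ r ≤ B) →
      ∑ j, (N j).card + (n - i) ≤ m →
      ∃ k ≤ 50 * m + 2, ∃ s' A₀' A₁' A₂' A₃',
        Steps program I B ⟨39, layout s A₀ A₁ A₂ A₃⟩ k ⟨85, layout s' A₀' A₁' A₂' A₃'⟩ ∧
        Consts s' n ∧ s' 14 = totalWeight T := by
  have hn1 : 1 ≤ n := by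
    obtain ⟨x⟩ := hT.1.nonempty
    exact x.pos
  have hn2 : n ≤ n * n := Nat.le_mul_of_pos_left n hn1
  have hn3 : n * n ≤ n ^ 3 := by
    rw [pow_succ, sq]
    exact Nat.le_mul_of_pos_right _ hn1
  induction m using Nat.strong_induction_on with
  | _ m ih =>
  intro N i v s A₀ A₁ A₂ A₃ hinv hR hm
  obtain ⟨R₁, step1, s₁, rfl, c₁, h12, h13, h14, h15⟩ := Wp.steps (P := program) (pc := 39)
    (b := [.sub 15 3 12]) (rest := program.drop 40) (I := I) (B := B)
    (Q := fun R => ∃ s', R = layout s' A₀ A₁ A₂ A₃ ∧ Consts s' n ∧ s' 12 = s 12 ∧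
      s' 13 = s 13 ∧ s' 14 = s 14 ∧ s' 15 = n - i)
    rfl hR (wp_compareBlock hinv.consts hinv.index (by omega)
      fun s' c h12 h13 h14 h15 => ⟨s', rfl, c, h12, h13, h14, h15⟩)
  replace hinv := hinv.congr c₁ h12 h13 h14
  clear h12 h13 h14
  rcases hinv.range with ⟨hi, hv⟩ | ⟨hi, hv⟩
  swap
  · refine ⟨2, by omega, s₁, A₀, A₁, A₂, A₃, step1.trans (.jumpZero_of_eq (a := 15) rfl
      step1.reg_le ?_), c₁, ?_⟩
    · rw [layout_of_lt _ _ _ _ _ (by omega), h15]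
      omega
    · have hempty : ∀ j, N j = ∅ := eq_empty_of_card_ne_one hT hinv.symm hinv.adj fun j =>
        hinv.leaf j (by omega) (by omega)
      rw [← hinv.acc]
      simp [hempty]
  lift v to Fin n using hv
  have hvB := v.2
  have hle₁ : ∀ r, layout s₁ A₀ A₁ A₂ A₃ r ≤ B := step1.reg_le
  have step2 : Steps program I B ⟨40, layout s₁ A₀ A₁ A₂ A₃⟩ 1 ⟨41, layout s₁ A₀ A₁ A₂ A₃⟩ := by
    refine .jumpZero_of_ne (a := 15) (l := 85) rfl step1.reg_le ?_
    rw [layout_of_lt _ _ _ _ _ (by omega), h15]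
    omega
  obtain ⟨R₂, step3, s₂, rfl, c₂, h10, h12, h13, h14, h15, h16⟩ := Wp.steps (P := program)
    (pc := 41) (b := lookupBlock) (rest := program.drop 46) (I := I) (B := B)
    (Q := fun R => ∃ s', R = layout s' A₀ A₁ A₂ A₃ ∧ Consts s' n ∧ s' 10 = v * 4 + 33 ∧
      s' 12 = s₁ 12 ∧ s' 13 = v ∧ s' 14 = s₁ 14 ∧ s' 15 = A₁ v ∧ s' 16 = A₀ v)
    rfl step2.reg_le (wp_lookupBlock hinv.consts hinv.vertex (by omega)
      (layout_zero s₁ A₀ A₁ A₂ A₃ v ▸ hle₁ _) (layout_one s₁ A₀ A₁ A₂ A₃ v ▸ hle₁ _)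
      fun s' c h10 h12 h13 h14 h15 h16 => ⟨s', rfl, c, h10, h12, h13, h14, h15, h16⟩)
  replace hinv := hinv.congr c₂ h12 (h13.trans hinv.vertex.symm) h14
  clear h12 h13 h14
  have steps₁ := (step1.trans step2).trans step3
  have hle : ∀ r, layout s₂ A₀ A₁ A₂ A₃ r ≤ B := step3.reg_le
  clear step1 step2 step3
  have next : ∀ s₃, PruneInv T N i v s₃ A₀ A₁ A₂ A₃ → (∀ r, layout s₃ A₀ A₁ A₂ A₃ r ≤ B) →
      (N v).card ≠ 1 → ∃ k ≤ 50 * (m - 1) + 5, ∃ s' A₀' A₁' A₂' A₃',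
        Steps program I B ⟨49, layout s₃ A₀ A₁ A₂ A₃⟩ k ⟨85, layout s' A₀' A₁' A₂' A₃'⟩ ∧
        Consts s' n ∧ s' 14 = totalWeight T := by
    intro s₃ hinv hR hcard
    obtain ⟨R₄, step1, s₄, rfl, c₄, h12, h13, h14⟩ := Wp.steps (P := program) (pc := 49)
      (b := nextBlock) (rest := program.drop 51) (I := I) (B := B)
      (Q := fun R => ∃ s', R = layout s' A₀ A₁ A₂ A₃ ∧ Consts s' n ∧ s' 12 = i + 1 ∧
        s' 13 = i + 1 ∧ s' 14 = s₃ 14)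
      rfl hR (wp_nextBlock hinv.consts hinv.index (by omega)
        fun s' c h12 h13 h14 => ⟨s', rfl, c, h12, h13, h14⟩)
    have step2 : Steps program I B ⟨51, _⟩ 1 ⟨39, _⟩ := .jump rfl step1.reg_le
    obtain ⟨k, hk, s', A₀', A₁', A₂', A₃', step3, hc, htot⟩ := ih (m - 1) (by omega) N (i + 1)
      (i + 1) s₄ _ _ _ _ (hinv.next hcard hi c₄ h12 h13 h14) step2.reg_le (by omega)
    refine ⟨_, ?_, s', A₀', A₁', A₂', A₃', (step1.trans step2).trans step3, hc, htot⟩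
    rw [show nextBlock.length = 2 from rfl]
    omega
  have hlookup : lookupBlock.length = 5 := rfl
  by_cases hzero : (N v).card = 0
  · have step4 : Steps program I B ⟨46, layout s₂ A₀ A₁ A₂ A₃⟩ 1
        ⟨49, layout s₂ A₀ A₁ A₂ A₃⟩ := by
      refine .jumpZero_of_eq (a := 15) rfl hle ?_
      rw [layout_of_lt _ _ _ _ _ (by omega), h15, hinv.current, hzero]
    obtain ⟨k, hk, s', A₀', A₁', A₂', A₃', step5, hc, htot⟩ := next s₂ hinv hle (by omega)
    refine ⟨_, ?_, s', A₀', A₁', A₂', A₃', (steps₁.trans step4).trans step5, hc, htot⟩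
    simp only [List.length_singleton]
    omega
  have step4 : Steps program I B ⟨46, layout s₂ A₀ A₁ A₂ A₃⟩ 1
      ⟨47, layout s₂ A₀ A₁ A₂ A₃⟩ := by
    refine .jumpZero_of_ne (a := 15) (l := 49) rfl hle ?_
    rwa [layout_of_lt _ _ _ _ _ (by omega), h15, hinv.current]
  have hcur : A₁ v ≤ B := layout_one s₂ A₀ A₁ A₂ A₃ v ▸ hle _
  obtain ⟨R₃, step5, s₃, rfl, c₃, h10', h11, h12, h13, h14, h16'⟩ := Wp.steps (P := program)
    (pc := 47) (b := [.sub 11 15 2]) (rest := program.drop 48) (I := I) (B := B)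
    (Q := fun R => ∃ s', R = layout s' A₀ A₁ A₂ A₃ ∧ Consts s' n ∧ s' 10 = s₂ 10 ∧
      s' 11 = A₁ v - 1 ∧ s' 12 = s₂ 12 ∧ s' 13 = s₂ 13 ∧ s' 14 = s₂ 14 ∧ s' 16 = s₂ 16)
    rfl hle (wp_predBlock hinv.consts h15 (by omega)
      fun s' c h10 h11 h12 h13 h14 h16 => ⟨s', rfl, c, h10, h11, h12, h13, h14, h16⟩)
  replace hinv := hinv.congr c₃ h12 h13 h14
  clear h12 h13 h14
  replace hle : ∀ r, layout s₃ A₀ A₁ A₂ A₃ r ≤ B := step5.reg_le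
  have steps₂ := (steps₁.trans step4).trans step5
  clear step4 step5
  by_cases hone : (N v).card = 1
  swap
  · have step6 : Steps program I B ⟨48, layout s₃ A₀ A₁ A₂ A₃⟩ 1
        ⟨49, layout s₃ A₀ A₁ A₂ A₃⟩ := by
      refine .jumpZero_of_ne (a := 11) (l := 52) rfl hle ?_
      rw [layout_of_lt _ _ _ _ _ (by omega), h11, hinv.current]
      omega
    obtain ⟨k, hk, s', A₀', A₁', A₂', A₃', step7, hc, htot⟩ := next s₃ hinv hle hone
    refine ⟨_, ?_, s', A₀', A₁', A₂', A₃', (steps₂.trans step6).trans step7, hc, htot⟩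
    simp only [List.length_singleton]
    omega
  have step6 : Steps program I B ⟨48, layout s₃ A₀ A₁ A₂ A₃⟩ 1
      ⟨52, layout s₃ A₀ A₁ A₂ A₃⟩ := by
    refine .jumpZero_of_eq (a := 11) rfl hle ?_
    rw [layout_of_lt _ _ _ _ _ (by omega), h11, hinv.current, hone]
  obtain ⟨p, hp⟩ := Finset.card_eq_one.1 hone
  have hpv' : p ∈ N v := by simp [hp]
  have hvp' : v ∈ N p := hinv.symm v p hpv'
  have hadj : T.Adj v p := hinv.adj v p hpv'
  have hpB := p.2
  have hnbr : A₂ v = p := by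
    rw [hinv.neighbours v ⟨p, hpv'⟩, hp, Finset.sum_singleton]
  have hadd := subtreeSize_add hT hadj
  rw [Fintype.card_fin] at hadd
  -- At a leaf the size invariant reads `A₃ v + subtreeSize T v p = n`, and the two directional
  -- sizes of an edge add up to `n`.
  have hsz : A₃ v = subtreeSize T p v := by
    have h := hinv.size v ⟨p, hpv'⟩
    rw [hp, Finset.sum_singleton] at h
    omega
  have hco : n - A₃ v = subtreeSize T v p := by omega
  have hszp : A₃ p + A₃ v ≤ n := by
    have h := hinv.size p ⟨v, hvp'⟩
    rw [← Finset.sum_erase_add _ _ hvp'] at h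
    omega
  have hdeg : ∀ j, T.degree j ≤ n := fun j => by
    simpa using (T.degree_lt_card_verts j).le
  have hcardp : (N p).card ≤ n := by simpa using Finset.card_le_univ (N p)
  have hnbrp : A₂ p ≤ B := layout_two s₃ A₀ A₁ A₂ A₃ p ▸ hle _
  have hw₁ : (A₀ p + A₀ p - 1) * A₃ v * A₃ v = weight T p v := by
    rw [hinv.degree, hsz, weight]
  have hw₂ : (A₀ v + A₀ v - 1) * (n - A₃ v) * (n - A₃ v) = weight T v p := by
    rw [hinv.degree, hco, weight]
  -- The two new weights are part of the sum still outstanding, so the accumulator never exceeds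
  -- `totalWeight T`.
  have hacc := hinv.acc
  rw [← sum_prune hinv.symm hp hadj.ne'] at hacc
  have hprod : ∀ (j : Fin n) (z : ℕ), z ≤ n → (A₀ j + A₀ j - 1) * z ≤ B := by
    intro j z hz
    have hj := hdeg j
    rw [hinv.degree]
    have : (T.degree j + T.degree j - 1) * z ≤ (2 * n) * n := Nat.mul_le_mul (by omega) hz
    rw [mul_assoc] at this
    omega
  have hdp := hdeg p
  have hdv := hdeg v
  obtain ⟨R₄, step7, s₄, rfl, c₄, h12, h13, h14⟩ := Wp.steps (P := program) (pc := 52)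
    (b := pruneBlock) (rest := program.drop 84) (I := I) (B := B)
    (Q := fun R => ∃ s', R = layout s' A₀
      (Function.update (Function.update A₁ v 0) p (A₁ p - 1)) (Function.update A₂ p (A₂ p - v))
      (Function.update A₃ p (A₃ p + A₃ v)) ∧ Consts s' n ∧ s' 12 = s₃ 12 ∧ s' 13 = p ∧
      s' 14 = s₃ 14 + (weight T p v + weight T v p))
    rfl step6.reg_le (wp_pruneBlock hinv.consts (h10'.trans h10) hinv.vertex rfl (h16'.trans h16)
      hnbr rfl rfl (fun h => hadj.ne' (Fin.ext h)) (by omega) (by omega) (by omega) (by omega)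
      (by rw [hinv.current]; omega) hnbrp (by omega) (by rw [hinv.degree]; omega)
      (by rw [hinv.degree]; omega) (hprod p _ (by omega)) (by rw [hw₁]; omega)
      (hprod v _ (by omega)) (by rw [hw₂]; omega) (by rw [hw₁, hw₂]; omega)
      fun s' c h12 h13 h14 => ⟨s', rfl, c, h12, h13, by rw [h14, hw₁, hw₂]⟩)
  have step8 : Steps program I B ⟨84, _⟩ 1 ⟨39, _⟩ := .jump rfl step7.reg_le
  have hmeasure := sum_prune hinv.symm hp hadj.ne' fun _ _ => 1
  simp only [Finset.sum_const, smul_eq_mul, mul_one] at hmeasure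
  obtain ⟨k, hk, s', A₀', A₁', A₂', A₃', step9, hc, htot⟩ := ih (m - 1) (by omega) (prune N v) i p
    s₄ _ _ _ _ (hinv.prune hp hadj.ne' hi hsz c₄ h12 h13 h14) step8.reg_le (by omega)
  refine ⟨_, ?_, s', A₀', A₁', A₂', A₃',
    (((steps₂.trans step6).trans step7).trans step8).trans step9, hc, htot⟩
  rw [show pruneBlock.length = 32 from rfl]
  simp only [List.length_singleton]
  omega

end PlanarLin

/-! ### Correctness and running time of the program -/

namespace PlanarLin

/-- Once the program counter has left the program the configuration is fixed, so the result and the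
register bound persist for all later times. -/
theorem Steps.computesWithin {P : List Instr} {I : List ℕ} {B k time : ℕ} {c : Config}
    (h : Steps P I B Config.init k c) (hc : P.length ≤ c.pc) (hk : k ≤ time) :
    ComputesWithin P I time B (c.reg 0) (c.reg 1) := by
  have hfix : ∀ t, k ≤ t → runFor P I t = c := by
    intro t ht
    obtain ⟨d, rfl⟩ := Nat.exists_eq_add_of_le' ht
    have hstep : step P I c = c := by
      rw [step, List.getElem?_eq_none hc]
    rw [runFor, Function.iterate_add_apply, h.1, Function.iterate_fixed hstep]
  refine ⟨?_, ?_, ?_, fun t r => ?_⟩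
  · rwa [hfix time hk]
  · rw [hfix time hk]
  · rw [hfix time hk]
  · by_cases ht : t ≤ k
    · exact h.2 t ht r
    · rw [hfix t (by omega)]
      exact h.reg_le r

theorem expectedPlanarD_nonneg {V : Type*} [Fintype V] [DecidableEq V] (T : SimpleGraph V)
    [DecidableRel T.Adj] : 0 ≤ expectedPlanarD T := by
  refine Finset.expect_nonneg fun π _ => Finset.sum_nonneg fun e _ => ?_
  induction e using Sym2.ind with
  | _ a b => exact abs_nonneg _

variable {n : ℕ} {T : SimpleGraph (Fin n)} [DecidableRel T.Adj]

theorem cast_totalWeight : (totalWeight T : ℚ) =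
    ∑ v, (2 * (T.degree v : ℚ) - 1) * ∑ u ∈ T.neighborFinset v, (subtreeSize T v u : ℚ) ^ 2 := by
  unfold totalWeight weight
  rw [Nat.cast_sum]
  refine Finset.sum_congr rfl fun v _ => ?_
  rw [Nat.cast_sum, Finset.mul_sum]
  refine Finset.sum_congr rfl fun u hu => ?_
  -- A vertex with a neighbour has positive degree, so the truncated subtraction in `weight` is
  -- exact.
  have hpos : 0 < T.degree v := by
    rw [← T.card_neighborFinset_eq_degree]
    exact Finset.card_pos.2 ⟨u, hu⟩
  rw [Nat.cast_mul, Nat.cast_mul, Nat.cast_sub (by omega)]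
  push_cast
  ring

/-- The expectation is nonnegative, so by the closed formula `totalWeight T` is at most the leading
term. This makes the final truncated subtraction exact and also bounds the accumulator. -/
theorem expectedPlanarD_eq_div (hT : T.IsTree) :
    totalWeight T ≤ (n * n * 3 + (n + n) - 2) * (n - 1) ∧ expectedPlanarD T =
      (((n * n * 3 + (n + n) - 2) * (n - 1) - totalWeight T : ℕ) : ℚ) / ((6 * n : ℕ) : ℚ) := by
  have hn1 : 1 ≤ n := by
    obtain ⟨x⟩ := hT.1.nonempty
    exact x.pos
  have hn : (0 : ℚ) < n := by exact_mod_cast hn1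
  have hE := expectedPlanarD_eq hT (Fintype.card_fin n)
  rw [← cast_totalWeight] at hE
  have hcast : (((n * n * 3 + (n + n) - 2) * (n - 1) : ℕ) : ℚ) =
      ((n : ℚ) - 1) * (3 * (n : ℚ) ^ 2 + 2 * (n : ℚ) - 2) := by
    rw [Nat.cast_mul, Nat.cast_sub (by omega), Nat.cast_sub hn1]
    push_cast
    ring
  have hE' : expectedPlanarD T =
      ((((n * n * 3 + (n + n) - 2) * (n - 1) : ℕ) : ℚ) - totalWeight T) / (6 * n) := by
    rw [hE, hcast]
    field_simp
  have hle : totalWeight T ≤ (n * n * 3 + (n + n) - 2) * (n - 1) := by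
    have h0 := expectedPlanarD_nonneg T
    rw [hE', le_div_iff₀ (by positivity), zero_mul, sub_nonneg] at h0
    exact_mod_cast h0
  refine ⟨hle, ?_⟩
  rw [hE', Nat.cast_sub hle]
  push_cast
  ring

theorem EdgeInv.pruneInv (hT : T.IsTree) {L : List (Fin n × Fin n)} (hL : IsEdgeList T L)
    {s A₀ A₁ A₂ A₃ : ℕ → ℕ} (h : EdgeInv L 0 s A₀ A₁ A₂ A₃) :
    PruneInv T (fun v => T.neighborFinset v) 0 0 s A₀ A₁ A₂ A₃ := by
  have hdeg : ∀ v, endSum (fun _ => 1) L v = T.degree v := by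
    intro v
    rw [endSum_eq hL, Finset.sum_const, smul_eq_mul, mul_one, T.card_neighborFinset_eq_degree]
  have hn : 0 < n := by
    obtain ⟨x⟩ := hT.1.nonempty
    exact x.pos
  exact
    { consts := h.consts
      index := h.index
      vertex := h.vertex
      symm := fun x y hxy => by simpa [T.adj_comm] using hxy
      adj := fun x y hxy => by simpa using hxy
      degree := fun j => (h.degree j).trans (hdeg j)
      current := fun j => by
        rw [h.current j, hdeg j, T.card_neighborFinset_eq_degree]
      neighbours := fun j _ => by
        rw [h.neighbours j, endSum_eq hL]
      size := fun j hj => by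
        rw [h.size j, sum_subtreeSize hT, Fintype.card_fin]
        rw [hdeg, ← T.card_neighborFinset_eq_degree]
        exact (Finset.card_pos.2 hj).ne'
      acc := by
        rw [h.acc, zero_add]
        rfl
      range := Or.inl ⟨hn, hn⟩
      leaf := fun j hj hj' => by omega }

theorem program_computesWithin (hT : T.IsTree) {L : List (Fin n × Fin n)}
    (hL : IsEdgeList T L) :
    ComputesWithin program (encodeInput L) (300 * n) (300 * n ^ 3)
      ((n * n * 3 + (n + n) - 2) * (n - 1) - totalWeight T) (6 * n) := by
  set B := 300 * n ^ 3 with hB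
  have hlen := hL.length_eq hT
  have hn1 : 1 ≤ n := by omega
  have hn2 : n ≤ n * n := Nat.le_mul_of_pos_left n hn1
  have hn3 : n * n ≤ n ^ 3 := by
    rw [pow_succ, sq]
    exact Nat.le_mul_of_pos_right _ hn1
  have hmain : (n * n * 3 + (n + n) - 2) * (n - 1) ≤ B := by
    calc (n * n * 3 + (n + n) - 2) * (n - 1) ≤ (5 * (n * n)) * n :=
          Nat.mul_le_mul (by omega) (by omega)
      _ = 5 * n ^ 3 := by ring
      _ ≤ B := by omega
  have hinit : Config.init = ⟨0, layout (fun _ => 0) (fun _ => 0) (fun _ => 0) (fun _ => 0)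
      (fun _ => 0)⟩ := by
    refine congrArg (Config.mk 0) ?_
    ext r
    simp [layout]
  obtain ⟨R₁, step1, s₁, rfl, c₁, h6, h7, h12, h13, h14⟩ := Wp.steps (P := program) (pc := 0)
    (b := initBlock) (rest := program.drop 6) (I := encodeInput L) (B := B)
    (Q := fun R => ∃ s', R = layout s' (fun _ => 0) (fun _ => 0) (fun _ => 0) (fun _ => 0) ∧
      Consts s' n ∧ s' 6 = n - 1 ∧ s' 7 = 1 ∧ s' 12 = 0 ∧ s' 13 = 0 ∧ s' 14 = 0)
    (R := layout (fun _ => 0) (fun _ => 0) (fun _ => 0) (fun _ => 0) (fun _ => 0)) rfl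
    (fun r => by simp [layout])
    (wp_initBlock (by omega) (by simp [encodeInput]) (by omega)
      fun s' c h6 h7 h12 h13 h14 => ⟨s', rfl, c, h6, h7, h12, h13, h14⟩)
  obtain ⟨k₂, hk₂, s₂, A₀, A₁, A₂, A₃, step2, hinv⟩ := edge_loop (B := B) le_rfl
    (fun e he => hL.ne he) hlen L [] s₁ (fun _ => 0) (fun _ => 0) (fun _ => 0) (fun _ => 0) rfl
    { consts := c₁
      count := by omega
      pointer := h7
      index := h12
      vertex := h13
      acc := h14
      degree := fun _ => rfl
      current := fun _ => rfl
      neighbours := fun _ => rfl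
      size := fun _ h => absurd rfl h } step1.reg_le
  -- The initial measure is `2(n - 1) + n`, at most `3 * n`.
  have hsum : ∑ j, (T.neighborFinset j).card + 2 = 2 * n := by
    simp only [T.card_neighborFinset_eq_degree]
    have h1 := T.sum_degrees_eq_twice_card_edges
    have h2 := hT.card_edgeFinset
    rw [Fintype.card_fin] at h2
    omega
  obtain ⟨hle, -⟩ := expectedPlanarD_eq_div hT
  obtain ⟨k₃, hk₃, s₃, A₀', A₁', A₂', A₃', step3, c₃, h14'⟩ := prune_loop hT
    (I := encodeInput L) (B := B) le_rfl (hle.trans hmain) (3 * n) _ 0 0 s₂ A₀ A₁ A₂ A₃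
    (hinv.pruneInv hT hL) step2.reg_le (by omega)
  obtain ⟨R₄, step4, h0, h1⟩ := Wp.steps (P := program) (pc := 85)
    (b := finalBlock) (rest := []) (I := encodeInput L) (B := B)
    (Q := fun R => R 0 = (n * n * 3 + (n + n) - 2) * (n - 1) - totalWeight T ∧ R 1 = 6 * n)
    rfl step3.reg_le (wp_finalBlock c₃ h14' (by omega) (by omega) (by omega) (by omega) hmain
      fun s' h0 h1 => by
        rw [layout_of_lt _ _ _ _ _ (by omega), layout_of_lt _ _ _ _ _ (by omega)]
        exact ⟨h0, h1⟩)
  have hsteps := ((step1.trans step2).trans step3).trans step4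
  rw [← hinit] at hsteps
  have hcw := hsteps.computesWithin (time := 300 * n) (show 97 ≤ 97 from le_rfl) (by
    rw [show initBlock.length = 6 from rfl, show finalBlock.length = 12 from rfl]
    omega)
  dsimp only at hcw
  rwa [h0, h1] at hcw

end PlanarLin

theorem proposition2 :
    -- the closed formula, for every free tree
    (∀ (V : Type*) [Fintype V] [DecidableEq V] (T : SimpleGraph V) [DecidableRel T.Adj] (n : ℕ),
      T.IsTree → Fintype.card V = n →
      PlanarLin.expectedPlanarD T =
        ((n : ℚ) - 1) * (3 * (n : ℚ) ^ 2 + 2 * (n : ℚ) - 2) / (6 * (n : ℚ)) -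
          1 / (6 * (n : ℚ)) *
            ∑ v : V, (2 * (T.degree v : ℚ) - 1) *
              ∑ u ∈ T.neighborFinset v, (PlanarLin.subtreeSize T v u : ℚ) ^ 2) ∧
    -- linear time: one program computes the value as a fraction, in `O(n)` steps on words of
    -- `O(log n)` bits, from any list of the edges of the tree
    (∃ (P : List PlanarLin.Instr) (c k : ℕ),
      ∀ (n : ℕ) (T : SimpleGraph (Fin n)) [DecidableRel T.Adj] (L : List (Fin n × Fin n)),
        T.IsTree → PlanarLin.IsEdgeList T L →
        ∃ a b : ℕ, b ≠ 0 ∧ PlanarLin.expectedPlanarD T = (a : ℚ) / (b : ℚ) ∧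
          PlanarLin.ComputesWithin P (PlanarLin.encodeInput L) (c * n) (c * n ^ k) a b) := by
  refine ⟨fun V _ _ T _ n hT hn => PlanarLin.expectedPlanarD_eq hT hn, ?_⟩
  refine ⟨PlanarLin.program, 300, 3, fun n T _ L hT hL => ⟨_, _, ?_,
    (PlanarLin.expectedPlanarD_eq_div hT).2, PlanarLin.program_computesWithin hT hL⟩⟩
  have := hL.length_eq hT
  omega
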